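/- Let $A$ be a finite alphabet, let $A^+$ and $A^*$ be the free semigroup and the free monoid on $A$, let $\#_1, \#_2 \notin A$ be two new symbols, and write $w^{\mathrm{rev}}$ for the reversal of a word $w$. A semigroup $S$ is called \emph{word-hyperbolic} if, for some finite alphabet $A$, there are a surjective homomorphism $\pi \colon A^+ \to S$ and a regular language $R \subseteq A^+$ with $\pi(R) = S$ such that the multiplication table $$\{\, u \,\#_1\, v \,\#_2\, w^{\mathrm{rev}} \;:\; u, v, w \in R,\ \pi(u)\pi(v) = \pi(w) \,\}$$ is a context-free language. A monoid $M$ is called word-hyperbolic if the same holds with $A^*$ in place of $A^+$ and with $\pi \colon A^* \to M$ a surjective monoid homomorphism. A semigroup $S$ is called (von Neumann) \emph{regular} if for every $a \in S$ there is $b \in S$ with $aba = a$. The \emph{semigroup free product} $S_1 \ast S_2$ is the coproduct of $S_1$ and $S_2$ in the category of semigroups; if $S_1$ and $S_2$ have identity elements, these are not identified. (1) If $M_1$ and $M_2$ are word-hyperbolic monoids, then the semigroup free product $M_1 \ast M_2$ is a word-hyperbolic semigroup. (2) If $S_1$ and $S_2$ are (von Neumann) regular word-hyperbolic semigroups, then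 the semigroup free product $S_1 \ast S_2$ is a word-hyperbolic semigroup. -/

import Mathlib

/-- The alphabet `A ∪ {#₁, #₂}`: the letters of `A` and two new symbols. -/
inductive MarkedLetter (A : Type) : Type
  | letter (a : A) : MarkedLetter A
  | hash₁ : MarkedLetter A
  | hash₂ : MarkedLetter A

/-- The non-empty word over `A` given by an element of the free semigroup `A⁺`. -/
def FreeSemigroup.toWord {A : Type} (w : FreeSemigroup A) : List A :=
  w.head :: w.tail

/-- The language of the words given by the elements of a subset `R` of the free semigroup or the
free monoid `W` on `A`, where `word` reads the elements of `W` as words over `A`. -/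
def wordLanguage {A : Type} {W : Type*} (word : W → List A) (R : Set W) : Language A :=
  word '' R

/-- The multiplication table `{u #₁ v #₂ wʳᵉᵛ | u, v, w ∈ R, π u * π v = π w}`. Here `W` is the
free semigroup or the free monoid on `A`, and `word` reads its elements as words over `A`. -/
def multiplicationTable {A : Type} {W S : Type*} [Mul S] (word : W → List A) (π : W → S)
    (R : Set W) : Language (MarkedLetter A) :=
  {x | ∃ u ∈ R, ∃ v ∈ R, ∃ w ∈ R, π u * π v = π w ∧
    x = (word u).map .letter ++ [.hash₁] ++ (word v).map .letter ++ [.hash₂] ++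
      (word w).reverse.map .letter}

/-- A semigroup `S` is word-hyperbolic if it is generated by a finite alphabet `A`, through a
surjective homomorphism `π : A⁺ → S`, and there is a regular language `R ⊆ A⁺` with `π(R) = S`
(a regular combing) whose multiplication table is context-free. -/
def IsWordHyperbolicSemigroup (S : Type*) [Semigroup S] : Prop :=
  ∃ (A : Type) (_ : Finite A) (π : FreeSemigroup A →ₙ* S) (R : Set (FreeSemigroup A)),
    Function.Surjective π ∧
    (wordLanguage FreeSemigroup.toWord R).IsRegular ∧
    π '' R = Set.univ ∧
    (multiplicationTable FreeSemigroup.toWord π R).IsContextFree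

/-- A monoid `M` is word-hyperbolic if it is generated by a finite alphabet `A`, through a
surjective homomorphism `π : A* → M`, and there is a regular language `R ⊆ A*` with `π(R) = M`
(a regular combing, which may contain the empty word) whose multiplication table is
context-free. -/
def IsWordHyperbolicMonoid (M : Type*) [Monoid M] : Prop :=
  ∃ (A : Type) (_ : Finite A) (π : FreeMonoid A →* M) (R : Set (FreeMonoid A)),
    Function.Surjective π ∧
    (wordLanguage FreeMonoid.toList R).IsRegular ∧
    π '' R = Set.univ ∧
    (multiplicationTable FreeMonoid.toList π R).IsContextFree

/-- A semigroup is (von Neumann) regular if every `a` satisfies `a = a b a` for some `b`. -/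
def IsVonNeumannRegular (S : Type*) [Semigroup S] : Prop :=
  ∀ a : S, ∃ b : S, a * b * a = a

/-- The defining relations of the semigroup free product: the products in each factor. -/
inductive SemigroupFreeProduct.Rel (S T : Type*) [Semigroup S] [Semigroup T] :
    FreeSemigroup (S ⊕ T) → FreeSemigroup (S ⊕ T) → Prop
  | left (a b : S) : Rel S T (.of (.inl a) * .of (.inl b)) (.of (.inl (a * b)))
  | right (a b : T) : Rel S T (.of (.inr a) * .of (.inr b)) (.of (.inr (a * b)))

/-- The semigroup free product `S ∗ T` (the coproduct in the category of semigroups): the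
semigroup presented by the disjoint union of `S` and `T` as generators, with the multiplication
tables of `S` and of `T` as defining relations. Identity elements of `S` and `T`, if any, are not
identified with anything. -/
def SemigroupFreeProduct (S T : Type*) [Semigroup S] [Semigroup T] : Type _ :=
  (conGen (SemigroupFreeProduct.Rel S T)).Quotient

instance SemigroupFreeProduct.instSemigroup (S T : Type*) [Semigroup S] [Semigroup T] :
    Semigroup (SemigroupFreeProduct S T) :=
  inferInstanceAs (Semigroup (conGen (SemigroupFreeProduct.Rel S T)).Quotient)

/-! Both statements are cases of `IsWordHyperbolicSemigroup.freeProduct`, which asks only that every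
element `s` of a factor have a right identity. In a monoid this is `1`; in a regular semigroup `s *
b * s = s` makes `b * s` one. A word-hyperbolic monoid is first turned into a word-hyperbolic
semigroup by adding a letter for `1`.

An element of the free product is a unique alternating sequence of elements of the factors, so
non-empty alternating products of words from the two combings form a combing. When two such
sequences are multiplied, at most the last entry of the first and the first entry of the second
merge. The merged entry stays in its factor and never disappears, since identities are not
identified with anything; hence there is no cascade. The table is therefore nested: outside the
junction, each piece of `u` or `v` faces a piece of `w` with the same value, and at the junction
there may be one product taken in a factor (`isContextFree_tableFrom`).

Facing pieces may be different words, so equality of combing words in a factor must be context-free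
too. If `e` is a right identity for the last letter of `u`, then it is one for `u`. The alphabet
being finite, finitely many words `e` suffice, and a transducer can select the triples with `v = e`
from the table and delete `v` (`isContextFree_equalityLanguage`).

Context-free languages are handled as components of least solutions of language equations. Infinite
context-free right-hand sides are allowed (`isContextFree_leastSolution`), which lets the tables of
the factors be inserted directly. -/

/-! ### Systems of language equations -/

/-- The words obtained from the string `s` by substituting for every nonterminal `n` a word
of the language `J n`. -/
def Language.yield {T N : Type*} (J : N → Language T) : List (Symbol T N) → Language T
  | [] => {w | w = []}
  | .terminal a :: s => {w | ∃ v ∈ yield J s, w = a :: v}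
  | .nonterminal n :: s => {w | ∃ u ∈ J n, ∃ v ∈ yield J s, w = u ++ v}

/-- The component at `n` of the least family `J` of languages such that `J n` contains the yield
of all strings in `K n`. -/
def Language.leastSolution {T N : Type*} (K : N → Language (Symbol T N)) (n : N) : Language T :=
  {w | ∀ J : N → Language T, (∀ m, ∀ s ∈ K m, ∀ v ∈ yield J s, v ∈ J m) → w ∈ J n}

namespace Language

variable {T U N : Type*}

section yield

variable {J J' : N → Language T} {s t : List (Symbol T N)} {w : List T}

@[simp] lemma mem_yield_nil : w ∈ yield J [] ↔ w = [] := Iff.rfl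

@[simp] lemma mem_yield_terminal {a : T} :
    w ∈ yield J (.terminal a :: s) ↔ ∃ v ∈ yield J s, w = a :: v := Iff.rfl

@[simp] lemma mem_yield_nonterminal {n : N} :
    w ∈ yield J (.nonterminal n :: s) ↔ ∃ u ∈ J n, ∃ v ∈ yield J s, w = u ++ v := Iff.rfl

lemma yield_mono (h : ∀ n, ∀ v ∈ J n, v ∈ J' n) : ∀ {s w}, w ∈ yield J s → w ∈ yield J' s
  | [], _, hw => hw
  | .terminal _ :: _, _, ⟨v, hv, e⟩ => ⟨v, yield_mono h hv, e⟩
  | .nonterminal _ :: _, _, ⟨u, hu, v, hv, e⟩ => ⟨u, h _ _ hu, v, yield_mono h hv, e⟩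

lemma mem_yield_append :
    w ∈ yield J (s ++ t) ↔ ∃ u ∈ yield J s, ∃ v ∈ yield J t, w = u ++ v := by
  induction s generalizing w with
  | nil => simp
  | cons a s ih =>
    cases a with
    | terminal a =>
      simp only [List.cons_append, mem_yield_terminal, ih]
      constructor
      · rintro ⟨_, ⟨u, hu, v, hv, rfl⟩, rfl⟩
        exact ⟨_, ⟨u, hu, rfl⟩, v, hv, rfl⟩
      · rintro ⟨_, ⟨u, hu, rfl⟩, v, hv, rfl⟩
        exact ⟨_, ⟨u, hu, v, hv, rfl⟩, rfl⟩
    | nonterminal n =>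
      simp only [List.cons_append, mem_yield_nonterminal, ih]
      constructor
      · rintro ⟨u', hu', _, ⟨u, hu, v, hv, rfl⟩, rfl⟩
        exact ⟨_, ⟨u', hu', u, hu, rfl⟩, v, hv, by simp⟩
      · rintro ⟨_, ⟨u', hu', u, hu, rfl⟩, v, hv, rfl⟩
        exact ⟨u', hu', _, ⟨u, hu, v, hv, rfl⟩, by simp⟩

lemma mem_yield_map_terminal_append {x : List T} :
    w ∈ yield J (x.map .terminal ++ s) ↔ ∃ v ∈ yield J s, w = x ++ v := by
  induction x generalizing w with
  | nil => simp
  | cons a x ih =>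
    simp only [List.map_cons, List.cons_append, mem_yield_terminal, ih]
    constructor
    · rintro ⟨_, ⟨v, hv, rfl⟩, rfl⟩
      exact ⟨v, hv, rfl⟩
    · rintro ⟨v, hv, rfl⟩
      exact ⟨_, ⟨v, hv, rfl⟩, rfl⟩

lemma mem_yield_map_terminal {x : List T} : w ∈ yield J (x.map .terminal) ↔ w = x := by
  rw [← List.append_nil (x.map _), mem_yield_map_terminal_append]
  simp

end yield

section leastSolution

variable {K : N → Language (Symbol T N)}

lemma leastSolution_subset (J : N → Language T)
    (h : ∀ m, ∀ s ∈ K m, ∀ v ∈ yield J s, v ∈ J m) {n : N} {w : List T}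
    (hw : w ∈ leastSolution K n) : w ∈ J n :=
  hw J h

/-- As in the Knaster–Tarski theorem, monotonicity of the yield makes the intersection of all closed
families closed itself. -/
lemma mem_leastSolution_of_yield {n : N} {s : List (Symbol T N)} (hs : s ∈ K n) {w : List T}
    (hw : w ∈ yield (leastSolution K) s) : w ∈ leastSolution K n :=
  fun J hJ ↦ hJ n s hs w (yield_mono (fun _ v (h : v ∈ leastSolution K _) ↦ h J hJ) hw)

end leastSolution

/-- The right-hand sides of the rules of a context-free grammar with given left-hand side. -/
def _root_.ContextFreeGrammar.outputs (g : ContextFreeGrammar T) (n : g.NT) :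
    Language (Symbol T g.NT) :=
  {s | ⟨n, s⟩ ∈ g.rules}

lemma _root_.ContextFreeGrammar.derives_of_mem_yield {g : ContextFreeGrammar T}
    {s : List (Symbol T g.NT)} {w : List T}
    (hw : w ∈ yield (fun n ↦ {w | g.Derives [.nonterminal n] (w.map .terminal)}) s) :
    g.Derives s (w.map .terminal) := by
  induction s generalizing w with
  | nil => rw [mem_yield_nil.1 hw]; rfl
  | cons a s ih =>
    cases a with
    | terminal a =>
      obtain ⟨v, hv, rfl⟩ := hw
      exact (ih hv).append_left [_]
    | nonterminal n =>
      obtain ⟨u, hu, v, hv, rfl⟩ := hw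
      have h₁ : g.Derives _ _ := ContextFreeGrammar.Derives.append_right hu s
      rw [List.map_append]
      exact h₁.trans ((ih hv).append_left _)

/-- Induction on the derivation from its first step: the part of the word produced by the output of
the rule lies in the least solution at its input, so the rewriting can be undone. -/
lemma _root_.ContextFreeGrammar.mem_yield_of_derives {g : ContextFreeGrammar T}
    {s : List (Symbol T g.NT)} {w : List T} (h : g.Derives s (w.map .terminal)) :
    w ∈ yield (leastSolution g.outputs) s := by
  induction h using Relation.ReflTransGen.head_induction_on with
  | refl => exact mem_yield_map_terminal.2 rfl
  | head hp _ ih =>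
    obtain ⟨r, hr, hrw⟩ := hp
    obtain ⟨p, q, rfl, rfl⟩ := hrw.exists_parts
    simp only [mem_yield_append] at ih ⊢
    obtain ⟨_, ⟨x, hx, y, hy, rfl⟩, z, hz, rfl⟩ := ih
    exact ⟨_, ⟨x, hx, y, ⟨y, mem_leastSolution_of_yield (s := r.output) hr hy, [], rfl,
      by simp⟩, rfl⟩, z, hz, rfl⟩

lemma _root_.ContextFreeGrammar.language_eq_leastSolution (g : ContextFreeGrammar T) :
    g.language = leastSolution g.outputs g.initial := by
  ext w
  rw [ContextFreeGrammar.mem_language_iff]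
  constructor
  · intro h
    obtain ⟨u, hu, v, rfl, rfl⟩ := ContextFreeGrammar.mem_yield_of_derives h
    simpa using hu
  · intro h
    refine leastSolution_subset (fun n ↦ {w | g.Derives [.nonterminal n] (w.map .terminal)})
      (fun m s hs v hv ↦ ?_) h
    exact ContextFreeGrammar.Produces.trans_derives
      ⟨⟨m, s⟩, hs, ContextFreeRule.Rewrites.input_output⟩
      (ContextFreeGrammar.derives_of_mem_yield hv)

/-- Only the rules must be finite in number, not the nonterminals. This allows nonterminals built
from an infinite type of transducer states of which finitely many are used. -/
lemma isContextFree_leastSolution_of_finite {N : Type} (K : N → Language (Symbol T N)) (n : N)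
    (hK : {p : N × List (Symbol T N) | p.2 ∈ K p.1}.Finite) :
    (leastSolution K n).IsContextFree := by
  classical
  refine ⟨⟨N, n, hK.toFinset.image fun p ↦ ⟨p.1, p.2⟩⟩, ?_⟩
  rw [ContextFreeGrammar.language_eq_leastSolution]
  congr 1
  ext m s
  simp only [ContextFreeGrammar.outputs, Finset.mem_image, Set.Finite.mem_toFinset]
  constructor
  · rintro ⟨p, hp, e⟩
    cases e
    exact hp
  · intro h
    exact ⟨(m, s), h, rfl⟩

lemma IsContextFree.exists_finite_system {L : Language T} (h : L.IsContextFree) :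
    ∃ (N : Type) (K : N → Language (Symbol T N)) (n : N),
      {p : N × List (Symbol T N) | p.2 ∈ K p.1}.Finite ∧ leastSolution K n = L := by
  obtain ⟨g, rfl⟩ := h
  refine ⟨g.NT, g.outputs, g.initial, ?_, g.language_eq_leastSolution.symm⟩
  refine (g.rules.finite_toSet.image fun r ↦ (r.input, r.output)).subset ?_
  rintro ⟨n, s⟩ h
  exact ⟨⟨n, s⟩, h, rfl⟩

/-! ### Nested substitution -/

/-- The symbol of the grammar for a nested substitution, with nonterminals `Σ m, M m`, for a symbol
of the grammar of the component at `n`. -/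
def nestSymbol {M : N → Type*} (i : ∀ n, M n) (n : N) :
    Symbol (Symbol T N) (M n) → Symbol T (Σ m, M m)
  | .terminal (.terminal a) => .terminal a
  | .terminal (.nonterminal m) => .nonterminal ⟨m, i m⟩
  | .nonterminal q => .nonterminal ⟨n, q⟩

/-- The least solution of a finite system of language equations whose right-hand sides are
context-free languages is context-free. -/
theorem isContextFree_leastSolution {N : Type} [Finite N] (K : N → Language (Symbol T N)) (n : N)
    (hK : ∀ m, (K m).IsContextFree) : (leastSolution K n).IsContextFree := by
  choose M G i hfin hG using fun m ↦ (hK m).exists_finite_system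
  let G' : (Σ m, M m) → Language (Symbol T (Σ m, M m)) :=
    fun p ↦ {s | ∃ t ∈ G p.1 p.2, s = t.map (nestSymbol i p.1)}
  have key : leastSolution K n = leastSolution G' ⟨n, i n⟩ := by
    -- To apply minimality of the component grammar, a string is judged by its yields: the strings
    -- all of whose yields lie in the merged solution form a closed family.
    have h₁ (m : N) (t : List (Symbol (Symbol T N) (M m))) (s : List (Symbol T N)) (v : List T)
        (hs : s ∈ yield (fun q ↦ {s | ∀ v ∈ yield (fun k ↦ leastSolution G' ⟨k, i k⟩) s,
          v ∈ leastSolution G' ⟨m, q⟩}) t)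
        (hv : v ∈ yield (fun k ↦ leastSolution G' ⟨k, i k⟩) s) :
        v ∈ yield (leastSolution G') (t.map (nestSymbol i m)) := by
      induction t generalizing s v with
      | nil =>
        cases mem_yield_nil.1 hs
        exact hv
      | cons a t ih =>
        rcases a with (a | k) | q
        · obtain ⟨s, hs, rfl⟩ := hs
          obtain ⟨v, hv, rfl⟩ := hv
          exact ⟨v, ih _ _ hs hv, rfl⟩
        · obtain ⟨s, hs, rfl⟩ := hs
          obtain ⟨u, hu, v, hv, rfl⟩ := hv
          exact ⟨u, hu, v, ih _ _ hs hv, rfl⟩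
        · obtain ⟨s', hs', s, hs, rfl⟩ := hs
          obtain ⟨u, hu, v, hv', rfl⟩ := mem_yield_append.1 hv
          exact ⟨u, hs' u hu, v, ih _ _ hs hv', rfl⟩
    -- Conversely, every word of the merged grammar factors through an intermediate string generated
    -- by a component.
    have h₂ (m : N) (t : List (Symbol (Symbol T N) (M m))) (w : List T)
        (hw : w ∈ yield (fun p : Σ m, M m ↦ {w | ∃ s ∈ leastSolution (G p.1) p.2,
          w ∈ yield (leastSolution K) s}) (t.map (nestSymbol i m))) :
        ∃ s ∈ yield (leastSolution (G m)) t, w ∈ yield (leastSolution K) s := by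
      induction t generalizing w with
      | nil => exact ⟨[], rfl, hw⟩
      | cons a t ih =>
        rcases a with (a | k) | q
        · obtain ⟨v, hv, rfl⟩ := hw
          obtain ⟨s, hs, hv⟩ := ih v hv
          exact ⟨_, ⟨s, hs, rfl⟩, v, hv, rfl⟩
        · obtain ⟨u, ⟨s', hs', hu⟩, v, hv, rfl⟩ := hw
          obtain ⟨s, hs, hv⟩ := ih v hv
          simp only [hG] at hs'
          exact ⟨_, ⟨s, hs, rfl⟩, u, mem_leastSolution_of_yield hs' hu, v, hv, rfl⟩
        · obtain ⟨u, ⟨s', hs', hu⟩, v, hv, rfl⟩ := hw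
          obtain ⟨s, hs, hv⟩ := ih v hv
          exact ⟨_, ⟨s', hs', s, hs, rfl⟩, mem_yield_append.2 ⟨u, hu, v, hv, rfl⟩⟩
    ext w
    constructor
    · intro hw
      refine leastSolution_subset (fun k ↦ leastSolution G' ⟨k, i k⟩) (fun m s hs v hv ↦ ?_) hw
      rw [← hG m] at hs
      refine leastSolution_subset (fun q ↦ {s | ∀ v ∈ yield (fun k ↦ leastSolution G' ⟨k, i k⟩) s,
          v ∈ leastSolution G' ⟨m, q⟩}) (fun q t ht s hs v hv ↦ ?_) hs v hv
      exact mem_leastSolution_of_yield (K := G') (n := ⟨m, q⟩) ⟨t, ht, rfl⟩ (h₁ m t s v hs hv)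
    · intro hw
      obtain ⟨s, hs, hw⟩ := leastSolution_subset (fun p : Σ m, M m ↦
        {w | ∃ s ∈ leastSolution (G p.1) p.2, w ∈ yield (leastSolution K) s}) (by
          rintro ⟨m, q⟩ _ ⟨t, ht, rfl⟩ v hv
          obtain ⟨s, hs, hv⟩ := h₂ m t v hv
          exact ⟨s, mem_leastSolution_of_yield ht hs, hv⟩) hw
      simp only [hG] at hs
      exact mem_leastSolution_of_yield hs hw
  rw [key]
  refine isContextFree_leastSolution_of_finite G' _ ?_
  refine (Set.finite_iUnion fun m ↦ (hfin m).image fun p ↦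
    ((⟨m, p.1⟩ : Σ m, M m), p.2.map (nestSymbol i m))).subset ?_
  rintro ⟨⟨m, q⟩, s⟩ ⟨t, ht, hs⟩
  exact Set.mem_iUnion.2 ⟨m, (q, t), ht, Prod.ext rfl hs.symm⟩

/-- A finite language is context-free. -/
lemma isContextFree_of_finite {L : Language T} (hL : Set.Finite {x | x ∈ L}) : L.IsContextFree := by
  let K : Unit → Language (Symbol T Unit) := fun _ ↦ {s | ∃ x ∈ L, s = x.map .terminal}
  have key : leastSolution K () = L := by
    ext w
    constructor
    · intro hw
      refine leastSolution_subset (fun _ ↦ L) ?_ hw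
      rintro _ _ ⟨x, hx, rfl⟩ v hv
      rwa [mem_yield_map_terminal.1 hv]
    · intro hw
      exact mem_leastSolution_of_yield (K := K) ⟨w, hw, rfl⟩ (mem_yield_map_terminal.2 rfl)
  rw [← key]
  refine isContextFree_leastSolution_of_finite K _ ?_
  refine (hL.image fun x ↦ ((), x.map Symbol.terminal)).subset ?_
  rintro ⟨_, _⟩ ⟨x, hx, rfl⟩
  exact ⟨x, hx, rfl⟩

end Language

/-! ### Deterministic transducers -/

/-- `Transduces δ p x q y`: the transducer with transition and output function `δ` has a run from
`p` to `q` that reads `x` and writes `y`. -/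
def Transduces {σ T U : Type*} (δ : σ → T → Option (σ × List U)) (p : σ) :
    List T → σ → List U → Prop
  | [], q, y => p = q ∧ y = []
  | a :: x, q, y => ∃ r o z, δ p a = some (r, o) ∧ Transduces δ r x q z ∧ y = o ++ z

namespace Transduces

variable {σ T U N : Type*} {δ : σ → T → Option (σ × List U)}

lemma append_iff {p q : σ} {x x' : List T} {y : List U} :
    Transduces δ p (x ++ x') q y ↔
      ∃ r z z', Transduces δ p x r z ∧ Transduces δ r x' q z' ∧ y = z ++ z' := by
  induction x generalizing p y with
  | nil => simp [Transduces]
  | cons a x ih =>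
    simp only [List.cons_append, Transduces, ih]
    constructor
    · rintro ⟨s, o, _, h, ⟨r, z, z', h₁, h₂, rfl⟩, rfl⟩
      exact ⟨r, _, z', ⟨s, o, z, h, h₁, rfl⟩, h₂, by simp⟩
    · rintro ⟨r, _, z', ⟨s, o, z, h, h₁, rfl⟩, h₂, rfl⟩
      exact ⟨s, o, _, h, ⟨r, z, z', h₁, h₂, rfl⟩, by simp⟩

lemma mem_of_closed {Q : Set σ} (hQ : ∀ p ∈ Q, ∀ a r o, δ p a = some (r, o) → r ∈ Q) {p q : σ}
    {x : List T} {y : List U} (h : Transduces δ p x q y) (hp : p ∈ Q) : q ∈ Q := by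
  induction x generalizing p y with
  | nil => exact h.1 ▸ hp
  | cons a x ih =>
    obtain ⟨r, o, z, h, h', rfl⟩ := h
    exact ih h' (hQ p hp a r o h)

end Transduces

/-- The strings obtained from a string over `T` and `N` by running a transducer with states in `Q`
on it from `p` to `q`, where the nonterminal `n` takes the transducer from any state to any other,
and becomes the triple of `n` and these states. -/
def Language.liftedStrings {σ T U N : Type*} (δ : σ → T → Option (σ × List U)) (Q : Set σ) :
    σ → List (Symbol T N) → σ → Language (Symbol U (Option (σ × N × σ)))
  | p, [], q => {s | p = q ∧ s = []}
  | p, .terminal a :: t, q => {s | ∃ r o, δ p a = some (r, o) ∧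
      ∃ s' ∈ liftedStrings δ Q r t q, s = o.map .terminal ++ s'}
  | p, .nonterminal n :: t, q => {s | ∃ r ∈ Q,
      ∃ s' ∈ liftedStrings δ Q r t q, s = .nonterminal (some (p, n, r)) :: s'}

namespace Language

variable {T U : Type*}

/-- Determinism leaves at most one choice at a terminal; a nonterminal offers one choice for each
state of the finite set `Q`. -/
lemma finite_liftedStrings {σ T U N : Type*} (δ : σ → T → Option (σ × List U)) {Q : Set σ}
    (hQ : Q.Finite) (p : σ) (t : List (Symbol T N)) (q : σ) :
    {s | s ∈ liftedStrings δ Q p t q}.Finite := by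
  induction t generalizing p with
  | nil => exact (Set.finite_singleton []).subset fun s hs ↦ hs.2
  | cons a t ih =>
    rcases a with a | n
    · cases h : δ p a with
      | none =>
        refine Set.finite_empty.subset ?_
        rintro _ ⟨r, o, h', -⟩
        simp [h] at h'
      | some ro =>
        refine ((ih ro.1).image fun s' ↦ ro.2.map .terminal ++ s').subset ?_
        rintro _ ⟨r, o, h', s', hs', rfl⟩
        rw [h] at h'
        cases h'
        exact ⟨s', hs', rfl⟩
    · refine (hQ.biUnion fun r _ ↦
        (ih r).image fun s' ↦ Symbol.nonterminal (some (p, n, r)) :: s').subset ?_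
      rintro _ ⟨r, hr, s', hs', rfl⟩
      exact Set.mem_biUnion hr ⟨s', hs', rfl⟩

lemma IsContextFree.congr {L M : Language T} (hL : L.IsContextFree) (h : ∀ x, x ∈ M ↔ x ∈ L) :
    M.IsContextFree :=
  (Language.ext h : M = L) ▸ hL

lemma IsRegular.congr {L M : Language T} (hL : L.IsRegular) (h : ∀ x, x ∈ M ↔ x ∈ L) :
    M.IsRegular :=
  (Language.ext h : M = L) ▸ hL

/-- The image of a context-free language under a deterministic transducer is context-free. -/
theorem IsContextFree.transduce {L : Language T} (hL : L.IsContextFree) {σ : Type}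
    (δ : σ → T → Option (σ × List U)) (Q : Set σ) (hQ : Q.Finite)
    (hδ : ∀ p ∈ Q, ∀ a r o, δ p a = some (r, o) → r ∈ Q) (p₀ : σ) (hp₀ : p₀ ∈ Q) (F : Set σ)
    (pre post : List U) :
    Language.IsContextFree
      {y | ∃ x ∈ L, ∃ q ∈ F, ∃ z, Transduces δ p₀ x q z ∧ y = pre ++ z ++ post} := by
  obtain ⟨N, K, n₀, hK, rfl⟩ := hL.exists_finite_system
  -- The triple construction: `(p, n, q)` generates the outputs of the runs from `p` to `q` on words
  -- of `n`, and `none` is a new start symbol that adds `pre` and `post`.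
  let K' : Option (σ × N × σ) → Language (Symbol U (Option (σ × N × σ)))
    | none => {s | ∃ q ∈ Q, q ∈ F ∧
        s = pre.map .terminal ++ .nonterminal (some (p₀, n₀, q)) :: post.map .terminal}
    | some (p, n, q) => {s | p ∈ Q ∧ q ∈ Q ∧ ∃ t ∈ K n, s ∈ liftedStrings δ Q p t q}
  let J : Option (σ × N × σ) → Language U
    | none => {y | ∃ x ∈ leastSolution K n₀, ∃ q ∈ F, ∃ z, Transduces δ p₀ x q z ∧
        y = pre ++ z ++ post}
    | some (p, n, q) => {y | ∃ x ∈ leastSolution K n, Transduces δ p x q y}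
  have h₁ (t : List (Symbol T N)) (p q : σ) (s : List (Symbol U (Option (σ × N × σ))))
      (hs : s ∈ liftedStrings δ Q p t q) (y : List U) (hy : y ∈ yield J s) :
      ∃ x ∈ yield (leastSolution K) t, Transduces δ p x q y := by
    induction t generalizing p s y with
    | nil =>
      obtain ⟨rfl, rfl⟩ := hs
      exact ⟨[], rfl, rfl, hy⟩
    | cons a t ih =>
      rcases a with a | n
      · obtain ⟨r, o, h, s, hs, rfl⟩ := hs
        obtain ⟨z, hz, rfl⟩ := mem_yield_map_terminal_append.1 hy
        obtain ⟨x, hx, hxz⟩ := ih r s hs z hz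
        exact ⟨a :: x, ⟨x, hx, rfl⟩, r, o, z, h, hxz, rfl⟩
      · obtain ⟨r, hr, s, hs, rfl⟩ := hs
        obtain ⟨u, ⟨x', hx', hxu⟩, y, hy, rfl⟩ := hy
        obtain ⟨x, hx, hxy⟩ := ih r s hs y hy
        exact ⟨x' ++ x, ⟨x', hx', x, hx, rfl⟩, Transduces.append_iff.2 ⟨r, u, y, hxu, hxy, rfl⟩⟩
  have h₂ (t : List (Symbol T N)) (p q : σ) (hp : p ∈ Q) (x : List T) (y : List U)
      (hx : x ∈ yield (fun n ↦ {x | ∀ p ∈ Q, ∀ q y, Transduces δ p x q y →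
        y ∈ leastSolution K' (some (p, n, q))}) t) (hxy : Transduces δ p x q y) :
      ∃ s ∈ liftedStrings δ Q p t q, y ∈ yield (leastSolution K') s := by
    induction t generalizing p x y with
    | nil =>
      cases mem_yield_nil.1 hx
      exact ⟨[], ⟨hxy.1, rfl⟩, hxy.2⟩
    | cons a t ih =>
      rcases a with a | n
      · obtain ⟨x, hx, rfl⟩ := hx
        obtain ⟨r, o, z, h, hz, rfl⟩ := hxy
        obtain ⟨s, hs, hsz⟩ := ih r (hδ p hp a r o h) x z hx hz
        exact ⟨_, ⟨r, o, h, s, hs, rfl⟩, mem_yield_map_terminal_append.2 ⟨z, hsz, rfl⟩⟩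
      · obtain ⟨x', hx', x, hx, rfl⟩ := hx
        obtain ⟨r, z', z, hz', hz, rfl⟩ := Transduces.append_iff.1 hxy
        have hr := hz'.mem_of_closed hδ hp
        obtain ⟨s, hs, hsz⟩ := ih r hr x z hx hz
        exact ⟨_, ⟨r, hr, s, hs, rfl⟩, z', hx' p hp r z' hz', z, hsz, rfl⟩
  have key : leastSolution K' none = J none := by
    ext w
    constructor
    · refine leastSolution_subset J ?_
      rintro (_ | ⟨p, n, q⟩) s hs y hy
      · obtain ⟨q, -, hqF, rfl⟩ := hs
        obtain ⟨_, ⟨z, ⟨x, hx, hxz⟩, v, hv, rfl⟩, rfl⟩ := mem_yield_map_terminal_append.1 hy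
        cases mem_yield_map_terminal.1 hv
        exact ⟨x, hx, q, hqF, z, hxz, by simp⟩
      · obtain ⟨-, -, t, ht, hs⟩ := hs
        obtain ⟨x, hx, hxy⟩ := h₁ t p q s hs y hy
        exact ⟨x, mem_leastSolution_of_yield ht hx, hxy⟩
    · rintro ⟨x, hx, q, hqF, z, hxz, rfl⟩
      -- Minimality is applied on the input side, to the words all of whose runs from states in `Q`
      -- have their output in the matching triple.
      have hz : z ∈ leastSolution K' (some (p₀, n₀, q)) := by
        refine leastSolution_subset (fun n ↦ {x | ∀ p ∈ Q, ∀ q y, Transduces δ p x q y →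
          y ∈ leastSolution K' (some (p, n, q))}) (fun n t ht x hx p hp q y hxy ↦ ?_)
          hx p₀ hp₀ q z hxz
        obtain ⟨s, hs, hsy⟩ := h₂ t p q hp x y hx hxy
        exact mem_leastSolution_of_yield (K := K') (n := some (p, n, q))
          ⟨hp, hxy.mem_of_closed hδ hp, t, ht, hs⟩ hsy
      refine mem_leastSolution_of_yield (K := K') (n := none)
        ⟨q, hxz.mem_of_closed hδ hp₀, hqF, rfl⟩ ?_
      rw [mem_yield_map_terminal_append]
      exact ⟨_, ⟨z, hz, post, mem_yield_map_terminal.2 rfl, rfl⟩, by simp⟩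
  change (J none).IsContextFree
  rw [← key]
  refine isContextFree_leastSolution_of_finite K' _ ?_
  refine Set.Finite.subset (Set.Finite.union (hQ.image fun q ↦ ((none : Option (σ × N × σ)),
    pre.map .terminal ++ .nonterminal (some (p₀, n₀, q)) :: post.map .terminal))
    (hK.biUnion fun k _ ↦ hQ.biUnion fun p _ ↦ hQ.biUnion fun q _ ↦
      (finite_liftedStrings δ hQ p k.2 q).image fun s ↦ (some (p, k.1, q), s))) ?_
  rintro ⟨_ | ⟨p, n, q⟩, s⟩ hs
  · obtain ⟨q, hq, -, rfl⟩ := hs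
    exact Or.inl ⟨q, hq, rfl⟩
  · obtain ⟨hp, hq, t, ht, hs⟩ := hs
    exact Or.inr (Set.mem_biUnion (x := (n, t)) ht
      (Set.mem_biUnion hp (Set.mem_biUnion hq ⟨s, hs, rfl⟩)))

/-! ### Closure of context-free languages under homomorphisms and unions -/

/-- The image of a context-free language under a homomorphism, with a fixed prefix and a fixed
suffix added, is context-free. -/
theorem IsContextFree.flatMap {L : Language T} (hL : L.IsContextFree) (f : T → List U)
    (pre post : List U) :
    Language.IsContextFree {y | ∃ x ∈ L, y = pre ++ x.flatMap f ++ post} := by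
  have key (x : List T) (z : List U) (q : Unit) :
      Transduces (fun _ a ↦ some ((), f a)) () x q z ↔ z = x.flatMap f := by
    induction x generalizing z with
    | nil => simp [Transduces]
    | cons a x ih => simp [Transduces, ih]
  refine (hL.transduce (fun (_ : Unit) a ↦ some ((), f a)) Set.univ Set.finite_univ
    (fun _ _ _ _ _ _ ↦ trivial) () trivial Set.univ pre post).congr fun y ↦ ?_
  constructor
  · rintro ⟨x, hx, rfl⟩
    exact ⟨x, hx, (), trivial, _, (key _ _ _).2 rfl, rfl⟩
  · rintro ⟨x, hx, q, -, z, hz, rfl⟩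
    rw [(key _ _ _).1 hz]
    exact ⟨x, hx, rfl⟩

theorem IsContextFree.map {L : Language T} (hL : L.IsContextFree) (f : T → U) :
    Language.IsContextFree {y | ∃ x ∈ L, y = x.map f} := by
  refine (hL.flatMap (fun a ↦ [f a]) [] []).congr fun y ↦ ?_
  change (∃ x ∈ L, _) ↔ ∃ x ∈ L, _
  simp only [List.nil_append, List.append_nil, List.map_eq_flatMap]

/-- The union of two context-free languages is context-free. -/
theorem IsContextFree.add {L M : Language T} (hL : L.IsContextFree) (hM : M.IsContextFree) :
    (L + M).IsContextFree := by
  let K : Option Bool → Language (Symbol T (Option Bool))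
    | none => {s | s = [.nonterminal (some true)] ∨ s = [.nonterminal (some false)]}
    | some true => {s | ∃ x ∈ L, s = x.map .terminal}
    | some false => {s | ∃ x ∈ M, s = x.map .terminal}
  have key : leastSolution K none = L + M := by
    ext w
    constructor
    · refine leastSolution_subset (fun n : Option Bool ↦ n.elim (L + M) fun b ↦ cond b L M) ?_
      rintro (_ | _ | _) s hs v hv
      · rcases hs with rfl | rfl
        · obtain ⟨u, hu, v, rfl, rfl⟩ := hv
          rw [List.append_nil]
          exact Or.inl hu
        · obtain ⟨u, hu, v, rfl, rfl⟩ := hv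
          rw [List.append_nil]
          exact Or.inr hu
      · obtain ⟨x, hx, rfl⟩ := hs
        rwa [mem_yield_map_terminal.1 hv]
      · obtain ⟨x, hx, rfl⟩ := hs
        rwa [mem_yield_map_terminal.1 hv]
    · rintro (hw | hw)
      · refine mem_leastSolution_of_yield (K := K) (n := none) (Or.inl rfl)
          ⟨w, ?_, [], rfl, by simp⟩
        exact mem_leastSolution_of_yield (K := K) (n := some true) ⟨w, hw, rfl⟩
          (mem_yield_map_terminal.2 rfl)
      · refine mem_leastSolution_of_yield (K := K) (n := none) (Or.inr rfl)
          ⟨w, ?_, [], rfl, by simp⟩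
        exact mem_leastSolution_of_yield (K := K) (n := some false) ⟨w, hw, rfl⟩
          (mem_yield_map_terminal.2 rfl)
  rw [← key]
  refine isContextFree_leastSolution K none ?_
  rintro (_ | _ | _)
  · exact isContextFree_of_finite (L := K none) ((Set.finite_singleton _).union
      (Set.finite_singleton _))
  · exact hM.map _
  · exact hL.map _

/-! ### Regular languages -/

lemma isRegular_of_nfa {σ : Type} [Finite σ] (M : NFA T σ) : M.accepts.IsRegular :=
  have := Fintype.ofFinite (Set σ)
  ⟨Set σ, this, M.toDFA, M.toDFA_correct⟩

/-- The image of a regular language under a map of the letters is regular. -/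
theorem IsRegular.map_letters {L : Language T} (hL : L.IsRegular) (f : T → U) :
    Language.IsRegular {y | ∃ x ∈ L, y = x.map f} := by
  obtain ⟨σ, _, M, rfl⟩ := hL
  let A : NFA U σ := ⟨fun q b ↦ {r | ∃ a, f a = b ∧ r = M.step q a}, {M.start}, M.accept⟩
  have key (y : List U) (S : Set σ) :
      y ∈ A.acceptsFrom S ↔ ∃ q ∈ S, ∃ x, M.evalFrom q x ∈ M.accept ∧ y = x.map f := by
    induction y generalizing S with
    | nil => simp [A]
    | cons b y ih =>
      rw [NFA.cons_mem_acceptsFrom, ih]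
      constructor
      · rintro ⟨r, hr, x, hx, rfl⟩
        obtain ⟨q, hq, a, rfl, rfl⟩ := NFA.mem_stepSet.1 hr
        exact ⟨q, hq, a :: x, hx, rfl⟩
      · rintro ⟨q, hq, _ | ⟨a, x⟩, hx, e⟩
        · simp at e
        · simp only [List.map_cons, List.cons.injEq] at e
          exact ⟨M.step q a, NFA.mem_stepSet.2 ⟨q, hq, a, e.1.symm, rfl⟩, x, hx, e.2⟩
  refine (isRegular_of_nfa A).congr fun y ↦ ?_
  rw [NFA.accepts_eq_acceptsFrom_start, key]
  change (∃ x ∈ M.accepts, _) ↔ _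
  simp [A, DFA.mem_accepts, DFA.eval]

/-- Prefixing all words of a regular language by a fixed letter gives a regular language. -/
theorem IsRegular.cons_letter {L : Language T} (hL : L.IsRegular) (a : T) :
    Language.IsRegular {y | ∃ x ∈ L, y = a :: x} := by
  obtain ⟨σ, _, M, rfl⟩ := hL
  -- The state `none` waits for the initial letter `a`.
  let A : NFA T (Option σ) := ⟨fun q b ↦ {r | (q = none ∧ b = a ∧ r = some M.start) ∨
    ∃ s, q = some s ∧ r = some (M.step s b)}, {none}, some '' M.accept⟩
  have key (y : List T) (q : σ) : y ∈ A.acceptsFrom {some q} ↔ M.evalFrom q y ∈ M.accept := by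
    induction y generalizing q with
    | nil => simp [A]
    | cons b y ih =>
      have : A.stepSet {some q} b = {some (M.step q b)} := by
        ext r
        simp [A]
      rw [NFA.cons_mem_acceptsFrom, this, ih, DFA.evalFrom_cons]
  refine (isRegular_of_nfa A).congr fun y ↦ ?_
  rw [NFA.accepts_eq_acceptsFrom_start]
  change (∃ x ∈ M.accepts, _) ↔ _
  cases y with
  | nil => simp [A]
  | cons b y =>
    rw [NFA.cons_mem_acceptsFrom]
    by_cases hb : b = a
    · have : A.stepSet A.start b = {some M.start} := by
        ext r
        simp [A, hb]
      rw [this, key]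
      simp [hb, DFA.mem_accepts, DFA.eval]
    · have : A.stepSet A.start b = ∅ := by
        ext r
        simp [A, hb]
      rw [this, NFA.mem_acceptsFrom, NFA.evalFrom_eq_biUnion_singleton]
      simp [hb]

/-- The words `x₁ ⋯ xₖ` with `xⱼ` taken alternately from `L i` and `L (!i)`. -/
inductive IsAlternating (L : Bool → Language T) : Bool → List T → Prop
  | nil (i : Bool) : IsAlternating L i []
  | append {i : Bool} {x y : List T} (hx : x ∈ L i) (hy : IsAlternating L (!i) y) :
      IsAlternating L i (x ++ y)

/-- The non-empty alternating products of words from two regular languages that do not contain the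
empty word form a regular language. -/
theorem isRegular_alternating {L : Bool → Language T} (hL : ∀ i, (L i).IsRegular)
    (hne : ∀ i, [] ∉ L i) :
    Language.IsRegular {w | w ≠ [] ∧ ∃ i, IsAlternating L i w} := by
  choose σ hσ M hM using hL
  -- There are no empty moves: at an accepting state the next letter may be read as the first letter
  -- of a piece for the other automaton. This needs non-empty pieces.
  let A : NFA T (Σ i, σ i) := ⟨fun p b ↦ {r | r = ⟨p.1, (M p.1).step p.2 b⟩ ∨
    (p.2 ∈ (M p.1).accept ∧ r = ⟨!p.1, (M !p.1).step (M !p.1).start b⟩)},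
    {p | p.2 = (M p.1).start}, {p | p.2 ∈ (M p.1).accept}⟩
  have hmem (i : Bool) (x : List T) : x ∈ L i ↔ (M i).evalFrom (M i).start x ∈ (M i).accept := by
    rw [← hM]
    rfl
  -- What remains to be read is the end `x` of the current piece, followed by an alternating word
  -- `y`.
  have key (w : List T) (S : Set (Σ i, σ i)) : w ∈ A.acceptsFrom S ↔ ∃ p ∈ S, ∃ x y,
      (M p.1).evalFrom p.2 x ∈ (M p.1).accept ∧ IsAlternating L (!p.1) y ∧ w = x ++ y := by
    induction w generalizing S with
    | nil =>
      rw [NFA.nil_mem_acceptsFrom]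
      constructor
      · rintro ⟨p, hp, h⟩
        exact ⟨p, hp, [], [], h, .nil _, rfl⟩
      · rintro ⟨p, hp, x, y, h, -, e⟩
        obtain ⟨rfl, rfl⟩ := List.append_eq_nil_iff.1 e.symm
        exact ⟨p, hp, h⟩
    | cons b w ih =>
      rw [NFA.cons_mem_acceptsFrom, ih]
      constructor
      · rintro ⟨r, hr, x, y, hx, hy, rfl⟩
        obtain ⟨p, hp, rfl | ⟨hacc, rfl⟩⟩ := NFA.mem_stepSet.1 hr
        · exact ⟨p, hp, b :: x, y, hx, hy, rfl⟩
        · exact ⟨p, hp, [], (b :: x) ++ y, hacc, .append ((hmem _ _).2 hx) hy, rfl⟩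
      · rintro ⟨p, hp, _ | ⟨a, x⟩, y, hx, hy, e⟩
        · rw [List.nil_append] at e
          subst e
          generalize hj : (!p.1) = j at hy
          generalize hv : b :: w = v at hy
          cases hy with
          | nil => simp at hv
          | @append _ x y hx' hy =>
            cases x with
            | nil => exact absurd hx' (hne _)
            | cons c x =>
              simp only [List.cons_append, List.cons.injEq] at hv
              obtain ⟨rfl, rfl⟩ := hv
              subst hj
              exact ⟨_, NFA.mem_stepSet.2 ⟨p, hp, Or.inr ⟨hx, rfl⟩⟩, x, y,
                (hmem _ _).1 hx', hy, rfl⟩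
        · simp only [List.cons_append, List.cons.injEq] at e
          obtain ⟨rfl, rfl⟩ := e
          exact ⟨_, NFA.mem_stepSet.2 ⟨p, hp, Or.inl rfl⟩, x, y, hx, hy, rfl⟩
  refine (isRegular_of_nfa A).congr fun w ↦ ?_
  rw [NFA.accepts_eq_acceptsFrom_start, key]
  constructor
  · rintro ⟨hw, i, h⟩
    cases h with
    | nil => exact absurd rfl hw
    | @append _ x y hx hy => exact ⟨⟨i, (M i).start⟩, rfl, x, y, (hmem _ _).1 hx, hy, rfl⟩
  · rintro ⟨⟨i, p⟩, hp, x, y, hx, hy, rfl⟩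
    change p = (M i).start at hp
    subst hp
    have hx' : x ∈ L i := (hmem _ _).2 hx
    refine ⟨fun e ↦ hne i ?_, i, .append hx' hy⟩
    rwa [(List.append_eq_nil_iff.1 e).1] at hx'

end Language

/-! ### Normal forms in semigroup free products -/

namespace FreeSemigroup

variable {A B : Type}

lemma toWord_mul (v w : FreeSemigroup A) : (v * w).toWord = v.toWord ++ w.toWord := rfl

lemma toWord_of (a : A) : (of a).toWord = [a] := rfl

lemma toWord_ne_nil (w : FreeSemigroup A) : w.toWord ≠ [] := List.cons_ne_nil _ _

lemma exists_toWord_eq {x : List A} (hx : x ≠ []) : ∃ w : FreeSemigroup A, w.toWord = x := by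
  cases x with
  | nil => exact absurd rfl hx
  | cons a x => exact ⟨⟨a, x⟩, rfl⟩

end FreeSemigroup

namespace SemigroupFreeProduct

variable {S T : Type*} [Semigroup S] [Semigroup T]

/-- The image of an element of one of the two factors in the free product. -/
def of (z : S ⊕ T) : SemigroupFreeProduct S T :=
  ((FreeSemigroup.of z : FreeSemigroup (S ⊕ T)) : (conGen (Rel S T)).Quotient)

lemma of_inl_mul (a b : S) :
    (of (.inl (a * b)) : SemigroupFreeProduct S T) = of (.inl a) * of (.inl b) :=
  ((conGen (Rel S T)).eq.2 (ConGen.Rel.of _ _ (.left a b))).symm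

lemma of_inr_mul (a b : T) :
    (of (.inr (a * b)) : SemigroupFreeProduct S T) = of (.inr a) * of (.inr b) :=
  ((conGen (Rel S T)).eq.2 (ConGen.Rel.of _ _ (.right a b))).symm

lemma induction_on {p : SemigroupFreeProduct S T → Prop} (g : SemigroupFreeProduct S T)
    (h₁ : ∀ z, p (of z)) (h₂ : ∀ z g, p g → p (of z * g)) : p g := by
  induction g using Con.induction_on with
  | H w =>
    induction w using FreeSemigroup.recOnMul with
    | ih1 z => exact h₁ z
    | ih2 z w _ hw => exact h₂ z _ hw

/-- Prefix a list of elements of the factors by another such element, multiplying it with the first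
entry of the list if both are in the same factor. -/
def consReduce : S ⊕ T → List (S ⊕ T) → List (S ⊕ T)
  | .inl a, .inl b :: l => .inl (a * b) :: l
  | .inr a, .inr b :: l => .inr (a * b) :: l
  | z, l => z :: l

lemma consReduce_nil (z : S ⊕ T) : consReduce z [] = [z] := by
  cases z <;> rfl

lemma consReduce_of_isLeft_ne {y z : S ⊕ T} (h : y.isLeft ≠ z.isLeft) (l : List (S ⊕ T)) :
    consReduce y (z :: l) = y :: z :: l := by
  cases y <;> cases z <;> simp_all [consReduce]

lemma exists_consReduce_of_isLeft_eq {y z : S ⊕ T} (h : y.isLeft = z.isLeft) :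
    ∃ c : S ⊕ T, c.isLeft = z.isLeft ∧ ∀ l, consReduce y (z :: l) = c :: l := by
  rcases y with a | a <;> rcases z with b | b
  · exact ⟨.inl (a * b), rfl, fun _ ↦ rfl⟩
  · exact absurd h (by simp)
  · exact absurd h (by simp)
  · exact ⟨.inr (a * b), rfl, fun _ ↦ rfl⟩

lemma exists_consReduce_eq_cons (z : S ⊕ T) (l : List (S ⊕ T)) :
    ∃ c l', consReduce z l = c :: l' ∧ c.isLeft = z.isLeft := by
  rcases z with z | z <;> rcases l with _ | ⟨y | y, l⟩ <;> exact ⟨_, _, rfl, rfl⟩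

/-- With its counterpart for the right factor, this says that the action on lists respects the
defining relations and so descends to the free product. -/
lemma consReduce_inl_mul (a b : S) (l : List (S ⊕ T)) :
    consReduce (.inl (a * b)) l = consReduce (.inl a) (consReduce (.inl b) l) := by
  rcases l with _ | ⟨y | y, l⟩ <;> simp [consReduce, mul_assoc]

lemma consReduce_inr_mul (a b : T) (l : List (S ⊕ T)) :
    consReduce (.inr (a * b)) l = consReduce (.inr a) (consReduce (.inr b) l) := by
  rcases l with _ | ⟨y | y, l⟩ <;> simp [consReduce, mul_assoc]

/-- The action of the free semigroup on the factors on lists of elements of the factors. -/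
def freeAct : FreeSemigroup (S ⊕ T) →ₙ* Function.End (List (S ⊕ T)) :=
  FreeSemigroup.lift consReduce

lemma freeAct_eq_of_conGen {v w : FreeSemigroup (S ⊕ T)} (h : conGen (Rel S T) v w) :
    freeAct v = freeAct w := by
  induction h with
  | of _ _ h =>
    cases h with
    | left a b => exact funext fun l ↦ (consReduce_inl_mul a b l).symm
    | right a b => exact funext fun l ↦ (consReduce_inr_mul a b l).symm
  | refl => rfl
  | symm _ ih => exact ih.symm
  | trans _ _ ih₁ ih₂ => exact ih₁.trans ih₂
  | mul _ _ ih₁ ih₂ => rw [map_mul, map_mul, ih₁, ih₂]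

/-- The action of the free product on lists of elements of the factors. -/
def act (g : SemigroupFreeProduct S T) : List (S ⊕ T) → List (S ⊕ T) :=
  Con.liftOn (c := conGen (Rel S T)) g (fun w ↦ freeAct w) fun _ _ h ↦ freeAct_eq_of_conGen h

lemma act_of (z : S ⊕ T) : act (of z) = consReduce z := rfl

lemma act_mul (g h : SemigroupFreeProduct S T) (l : List (S ⊕ T)) :
    act (g * h) l = act g (act h l) := by
  induction g using Con.induction_on with
  | H v =>
    induction h using Con.induction_on with
    | H w => exact congrFun (map_mul freeAct v w) l

/-- Multiplying out the entries of a list turns the action into left multiplication. The empty list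
needs a product, hence `WithOne`. -/
lemma prod_act (g : SemigroupFreeProduct S T) (l : List (S ⊕ T)) :
    ((act g l).map fun z ↦ (of z : WithOne (SemigroupFreeProduct S T))).prod =
      g * (l.map fun z ↦ (of z : WithOne (SemigroupFreeProduct S T))).prod := by
  induction g using induction_on generalizing l with
  | h₁ z =>
    rcases z with z | z <;> rcases l with _ | ⟨y | y, l⟩ <;>
      simp [act_of, consReduce, of_inl_mul, of_inr_mul, mul_assoc]
  | h₂ z g hg =>
    rw [act_mul, WithOne.coe_mul, mul_assoc, ← hg]
    generalize act g l = l
    rcases z with z | z <;> rcases l with _ | ⟨y | y, l⟩ <;>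
      simp [act_of, consReduce, of_inl_mul, of_inr_mul, mul_assoc]

/-- The list `act g []` serves as the normal form of `g`: multiplying it out gives back `g`. -/
lemma act_nil_injective :
    Function.Injective fun g : SemigroupFreeProduct S T ↦ act g [] := by
  intro g h e
  have := prod_act g []
  rw [show act g [] = act h [] from e, prod_act] at this
  simpa using this.symm

variable {B : Type} {lv : B → S ⊕ T}

lemma act_lift (w : FreeSemigroup B) (l : List (S ⊕ T)) :
    act (FreeSemigroup.lift (fun b ↦ (of (lv b) : SemigroupFreeProduct S T)) w) l =
      w.toWord.foldr (fun b ↦ consReduce (lv b)) l := by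
  induction w using FreeSemigroup.recOnMul generalizing l with
  | ih1 b => rfl
  | ih2 b w _ hw =>
    rw [map_mul, act_mul, hw, FreeSemigroup.toWord_mul, List.foldr_append]
    rfl

end SemigroupFreeProduct

/-! ### The language of pairs of equal words -/

/-- The language `{u #₁ wʳᵉᵛ | u, w ∈ R, π u = π w}`. -/
def equalityLanguage {A : Type} {W S : Type*} (word : W → List A) (π : W → S) (R : Set W) :
    Language (MarkedLetter A) :=
  {x | ∃ u ∈ R, ∃ w ∈ R, π u = π w ∧
    x = (word u).map .letter ++ .hash₁ :: (word w).reverse.map .letter}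

/-- The states of the transducer that deletes a right identity, given by the last letter of `u`,
from `u #₁ v #₂ w`. -/
inductive RightIdentityState (A : Type) : Type
  | before (a : Option A) : RightIdentityState A
  | inside (r : List A) : RightIdentityState A
  | after : RightIdentityState A

namespace RightIdentityState

variable {A : Type}

open Classical in
/-- The transducer that takes `u #₁ v #₂ w` to `u #₁ w` if `v` is `e a` for the last letter `a` of
`u`. -/
noncomputable def step (e : A → List A) : RightIdentityState A → MarkedLetter A →
    Option (RightIdentityState A × List (MarkedLetter A))
  | before _, .letter a => some (before (some a), [.letter a])
  | before (some a), .hash₁ => some (inside (e a), [.hash₁])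
  | inside (b :: r), .letter a => if a = b then some (inside r, []) else none
  | inside [], .hash₂ => some (after, [])
  | after, .letter a => some (after, [.letter a])
  | _, _ => none

variable {e : A → List A} {q : RightIdentityState A} {y : List (MarkedLetter A)}

/-- The fold computes the last letter of `u`, or `o` if `u` is empty. -/
lemma transduces_before {o : Option A} {u : List A} {t : List (MarkedLetter A)} :
    Transduces (step e) (before o) (u.map .letter ++ t) q y ↔
      ∃ z, Transduces (step e) (before (u.foldl (fun _ a ↦ some a) o)) t q z ∧
        y = u.map .letter ++ z := by
  induction u generalizing o y with
  | nil => simp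
  | cons a u ih =>
    simp only [List.map_cons, List.cons_append, Transduces, List.foldl_cons]
    constructor
    · rintro ⟨r, _, _, h, h', rfl⟩
      simp only [step, Option.some.injEq, Prod.mk.injEq] at h
      obtain ⟨rfl, rfl⟩ := h
      obtain ⟨z, hz, rfl⟩ := ih.1 h'
      exact ⟨z, hz, rfl⟩
    · rintro ⟨z, hz, rfl⟩
      exact ⟨_, _, _, rfl, ih.2 ⟨z, hz, rfl⟩, rfl⟩

lemma transduces_inside {r v : List A} {t : List (MarkedLetter A)} :
    Transduces (step e) (inside r) (v.map .letter ++ .hash₂ :: t) q y ↔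
      v = r ∧ Transduces (step e) after t q y := by
  induction v generalizing r with
  | nil => cases r <;> simp [Transduces, step]
  | cons a v ih =>
    cases r with
    | nil => simp [Transduces, step]
    | cons b r =>
      by_cases h : a = b
      · simp [Transduces, step, h, ih]
      · simp [Transduces, step, h]

lemma transduces_after {w : List A} :
    Transduces (step e) after (w.map .letter) q y ↔ q = after ∧ y = w.map .letter := by
  induction w generalizing y with
  | nil => simp [Transduces, eq_comm]
  | cons a w ih =>
    simp only [List.map_cons, Transduces]
    constructor
    · rintro ⟨r, _, _, h, h', rfl⟩
      simp only [step, Option.some.injEq, Prod.mk.injEq] at h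
      obtain ⟨rfl, rfl⟩ := h
      obtain ⟨hq, rfl⟩ := ih.1 h'
      exact ⟨hq, rfl⟩
    · rintro ⟨hq, rfl⟩
      exact ⟨_, _, _, rfl, ih.2 ⟨hq, rfl⟩, rfl⟩

lemma transduces_iff {u v w : List A} :
    Transduces (step e) (before none)
        (u.map .letter ++ .hash₁ :: (v.map .letter ++ .hash₂ :: w.map .letter)) q y ↔
      ∃ a, u.foldl (fun _ a ↦ some a) none = some a ∧ v = e a ∧ q = after ∧
        y = u.map .letter ++ .hash₁ :: w.map .letter := by
  rw [transduces_before]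
  cases u.foldl (fun _ a ↦ some a) none with
  | none => simp [Transduces, step]
  | some a =>
    constructor
    · rintro ⟨_, ⟨r, _, _, h, h', rfl⟩, rfl⟩
      simp only [step, Option.some.injEq, Prod.mk.injEq] at h
      obtain ⟨rfl, rfl⟩ := h
      obtain ⟨rfl, h''⟩ := transduces_inside.1 h'
      obtain ⟨rfl, rfl⟩ := transduces_after.1 h''
      exact ⟨a, rfl, rfl, rfl, rfl⟩
    · rintro ⟨b, h, rfl, rfl, rfl⟩
      cases h
      exact ⟨_, ⟨_, _, _, rfl, transduces_inside.2 ⟨rfl, transduces_after.2 ⟨rfl, rfl⟩⟩, rfl⟩, rfl⟩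

/-- The type of states is infinite, but from the initial state the lists stored in `inside` are only
suffixes of the finitely many words `e a`. -/
lemma exists_finite_closed [Finite A] (e : A → List A) :
    ∃ Q : Set (RightIdentityState A), Q.Finite ∧ before none ∈ Q ∧
      ∀ p ∈ Q, ∀ a r o, step e p a = some (r, o) → r ∈ Q := by
  refine ⟨Set.range before ∪ (inside '' ⋃ a, {r | r <:+ e a}) ∪ {after}, ?_,
    Or.inl (Or.inl ⟨none, rfl⟩), ?_⟩
  · refine ((Set.finite_range _).union (Set.Finite.image _
      (Set.finite_iUnion fun a ↦ ?_))).union (Set.finite_singleton _)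
    exact (List.finite_toSet (e a).tails).subset fun r hr ↦ (List.mem_tails _ _).2 hr
  · rintro p ((⟨o, rfl⟩ | ⟨r, hr, rfl⟩) | rfl) a q y h
    · cases a with
      | letter a =>
        cases h
        exact Or.inl (Or.inl ⟨_, rfl⟩)
      | hash₁ =>
        cases o with
        | none => cases h
        | some b =>
          cases h
          exact Or.inl (Or.inr ⟨_, Set.mem_iUnion.2 ⟨b, List.suffix_rfl⟩, rfl⟩)
      | hash₂ => simp [step] at h
    · obtain ⟨c, hr⟩ := Set.mem_iUnion.1 hr
      cases r with
      | nil =>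
        cases a with
        | hash₂ =>
          cases h
          exact Or.inr rfl
        | _ => cases h
      | cons b r =>
        cases a with
        | letter a =>
          by_cases hab : a = b
          · simp only [step, hab, if_true, Option.some.injEq, Prod.mk.injEq] at h
            exact Or.inl (Or.inr ⟨r, Set.mem_iUnion.2 ⟨c, (List.suffix_cons b r).trans hr⟩, h.1⟩)
          · simp [step, hab] at h
        | _ => cases h
    · cases a with
      | letter a =>
        cases h
        exact Or.inr rfl
      | _ => cases h

end RightIdentityState

/-- An element fixing the value of the last letter from the right fixes the value of the whole word,
by associativity. Thus right identities for the letters suffice. -/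
lemma FreeSemigroup.exists_last {A : Type} {S : Type*} [Semigroup S] (π : FreeSemigroup A →ₙ* S)
    (w : FreeSemigroup A) (o : Option A) :
    ∃ a, w.toWord.foldl (fun _ a ↦ some a) o = some a ∧
      ∀ s, π (of a) * s = π (of a) → π w * s = π w := by
  induction w using FreeSemigroup.recOnMul generalizing o with
  | ih1 a => exact ⟨a, rfl, fun _ h ↦ h⟩
  | ih2 b w _ hw =>
    rw [toWord_mul, List.foldl_append]
    obtain ⟨a, ha, h⟩ := hw (List.foldl (fun _ a ↦ some a) o (of b).toWord)
    exact ⟨a, ha, fun s hs ↦ by rw [map_mul, mul_assoc, h s hs]⟩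

lemma mem_multiplicationTable {A : Type} {W S : Type*} [Mul S] {word : W → List A} {π : W → S}
    {R : Set W} {x : List (MarkedLetter A)} :
    x ∈ multiplicationTable word π R ↔ ∃ u ∈ R, ∃ v ∈ R, ∃ w ∈ R, π u * π v = π w ∧
      x = (word u).map .letter ++ .hash₁ :: ((word v).map .letter ++ .hash₂ ::
        (word w).reverse.map .letter) := by
  simp only [multiplicationTable, List.append_assoc, List.singleton_append]
  rfl

/-- If every element has a right identity, then equality of words of a combing with context-free
multiplication table is context-free. -/
theorem isContextFree_equalityLanguage {A : Type} [Finite A] {S : Type*} [Semigroup S]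
    (π : FreeSemigroup A →ₙ* S) (R : Set (FreeSemigroup A)) (hR : π '' R = Set.univ)
    (hT : (multiplicationTable FreeSemigroup.toWord π R).IsContextFree)
    (hS : ∀ s : S, ∃ e, s * e = s) :
    (equalityLanguage FreeSemigroup.toWord π R).IsContextFree := by
  -- The right identities are represented by words of `R`, so that they occur as middle words in the
  -- table.
  have h (a : A) : ∃ e ∈ R, π (.of a) * π e = π (.of a) := by
    obtain ⟨s, hs⟩ := hS (π (.of a))
    obtain ⟨e, he, rfl⟩ : s ∈ π '' R := hR ▸ Set.mem_univ s
    exact ⟨e, he, hs⟩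
  choose e heR he using h
  obtain ⟨Q, hQ, h₀, hδ⟩ := RightIdentityState.exists_finite_closed fun a ↦ (e a).toWord
  refine (hT.transduce _ Q hQ hδ _ h₀ {.after} [] []).congr fun y ↦ ?_
  constructor
  · rintro ⟨u, hu, w, hw, huw, rfl⟩
    obtain ⟨a, ha, hua⟩ := FreeSemigroup.exists_last π u none
    refine ⟨_, mem_multiplicationTable.2 ⟨u, hu, e a, heR a, w, hw, ?_, rfl⟩, .after, rfl, _,
      RightIdentityState.transduces_iff.2 ⟨a, ha, rfl, rfl, rfl⟩, by simp⟩
    rw [hua _ (he a), huw]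
  · rintro ⟨x, hx, q, -, z, hz, rfl⟩
    obtain ⟨u, hu, v, hv, w, hw, huvw, rfl⟩ := mem_multiplicationTable.1 hx
    obtain ⟨a, ha, hv', -, rfl⟩ := RightIdentityState.transduces_iff.1 hz
    obtain ⟨b, hb, hub⟩ := FreeSemigroup.exists_last π u none
    rw [ha] at hb
    cases hb
    have : v = e a := by
      cases v
      cases h : e a
      simp only [h, FreeSemigroup.toWord, List.cons.injEq] at hv'
      rw [hv'.1, hv'.2]
    subst this
    exact ⟨u, hu, w, hw, by rw [← huvw, hub _ (he a)], by simp⟩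

/-! ### From monoids to semigroups -/

/-- A word-hyperbolic monoid is a word-hyperbolic semigroup. -/
theorem IsWordHyperbolicMonoid.isWordHyperbolicSemigroup {M : Type*} [Monoid M]
    (h : IsWordHyperbolicMonoid M) : IsWordHyperbolicSemigroup M := by
  obtain ⟨A, _, π, R, -, hreg, hR, hT⟩ := h
  -- The new letter `none` stands for `1`; putting it in front of every combing word makes all of
  -- them non-empty.
  let π' : FreeSemigroup (Option A) →ₙ* M := FreeSemigroup.lift fun o ↦ o.elim 1 fun a ↦ π (.of a)
  let f (r : FreeMonoid A) : FreeSemigroup (Option A) := ⟨none, r.toList.map some⟩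
  have hπ' (w : FreeSemigroup (Option A)) :
      π' w = (w.toWord.map fun o ↦ o.elim 1 fun a ↦ π (.of a)).prod := by
    induction w using FreeSemigroup.recOnMul with
    | ih1 a => exact (mul_one _).symm
    | ih2 a w ha hw => rw [map_mul, ha, hw, FreeSemigroup.toWord_mul, List.map_append,
        List.prod_append]
  have hf (r : FreeMonoid A) : π' (f r) = π r := by
    rw [hπ']
    simp only [f, FreeSemigroup.toWord, List.map_cons, Option.elim_none, List.map_map,
      List.prod_cons, one_mul]
    induction r using FreeMonoid.inductionOn' with
    | one => simp
    | of_mul a r ih => simp [ih]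
  have hR' : π' '' (f '' R) = Set.univ := by
    rw [← hR, Set.image_image]
    exact Set.image_congr' hf
  refine ⟨Option A, inferInstance, π', f '' R, fun s ↦ ?_, ?_, hR', ?_⟩
  · obtain ⟨w, -, hw⟩ : s ∈ π' '' (f '' R) := hR' ▸ Set.mem_univ s
    exact ⟨w, hw⟩
  · refine ((hreg.map_letters some).cons_letter none).congr fun x ↦ ?_
    constructor
    · rintro ⟨_, ⟨r, hr, rfl⟩, rfl⟩
      exact ⟨_, ⟨_, ⟨r, hr, rfl⟩, rfl⟩, rfl⟩
    · rintro ⟨_, ⟨_, ⟨r, hr, rfl⟩, rfl⟩, rfl⟩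
      exact ⟨_, ⟨r, hr, rfl⟩, rfl⟩
  -- The three new letters are the prefix for `u`, the one inserted after `#₁` for `v`, and the
  -- suffix for `w`, which is written backwards.
  · let g : MarkedLetter A → List (MarkedLetter (Option A))
      | .letter a => [.letter (some a)]
      | .hash₁ => [.hash₁, .letter none]
      | .hash₂ => [.hash₂]
    have hg (x : List A) : (x.map MarkedLetter.letter).flatMap g =
        (x.map some).map MarkedLetter.letter := by
      induction x with
      | nil => rfl
      | cons a x ih => simpa [g] using ih
    refine (hT.flatMap g [.letter none] [.letter none]).congr fun x ↦ ?_
    have key (u v w : FreeMonoid A) : [.letter none] ++ (u.toList.map MarkedLetter.letter ++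
        MarkedLetter.hash₁ :: (v.toList.map MarkedLetter.letter ++ MarkedLetter.hash₂ ::
          w.toList.reverse.map MarkedLetter.letter)).flatMap g ++ [.letter none] =
        (f u).toWord.map .letter ++ .hash₁ :: ((f v).toWord.map .letter ++ .hash₂ ::
          (f w).toWord.reverse.map .letter) := by
      simp only [List.flatMap_append, List.flatMap_cons, hg, f, FreeSemigroup.toWord]
      simp only [g]
      simp
    rw [mem_multiplicationTable]
    constructor
    · rintro ⟨_, ⟨u, hu, rfl⟩, _, ⟨v, hv, rfl⟩, _, ⟨w, hw, rfl⟩, h, rfl⟩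
      rw [hf, hf, hf] at h
      exact ⟨_, mem_multiplicationTable.2 ⟨u, hu, v, hv, w, hw, h, rfl⟩, (key u v w).symm⟩
    · rintro ⟨_, hx, rfl⟩
      obtain ⟨u, hu, v, hv, w, hw, h, rfl⟩ := mem_multiplicationTable.1 hx
      rw [← hf, ← hf, ← hf] at h
      exact ⟨_, ⟨u, hu, rfl⟩, _, ⟨v, hv, rfl⟩, _, ⟨w, hw, rfl⟩, h, key u v w⟩

/-! ### The multiplication table of a free product -/

/-- The words `x₁ ⋯ xₖ` with values `z₁, …, zₖ`, where `xⱼ` has value `zⱼ` with respect to `P i` and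
`P (!i)` alternately. -/
inductive AlternatingWord {B Z : Type*} (P : Bool → List B → Z → Prop) :
    Bool → List B → List Z → Prop
  | nil (i : Bool) : AlternatingWord P i [] []
  | append {i : Bool} {x y : List B} {z : Z} {l : List Z} (hx : P i x z)
      (hy : AlternatingWord P (!i) y l) : AlternatingWord P i (x ++ y) (z :: l)

lemma AlternatingWord.isLeft_eq {B S T : Type*} {P : Bool → List B → S ⊕ T → Prop}
    (hP : ∀ i x z, P i x z → z.isLeft = i) {i : Bool} {x : List B} {z : S ⊕ T} {l : List (S ⊕ T)}
    (h : AlternatingWord P i x (z :: l)) : z.isLeft = i := by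
  cases h with
  | append hx _ => exact hP _ _ _ hx

lemma AlternatingWord.eq_nil_iff {B Z : Type*} {P : Bool → List B → Z → Prop}
    (hne : ∀ i x z, P i x z → x ≠ []) {i : Bool} {x : List B} {l : List Z}
    (h : AlternatingWord P i x l) : x = [] ↔ l = [] := by
  cases h with
  | nil => simp
  | append hx _ => simp [hne _ _ _ hx]

lemma Language.isAlternating_iff {B Z : Type*} {P : Bool → List B → Z → Prop} {i : Bool}
    {x : List B} :
    IsAlternating (fun i ↦ {x | ∃ z, P i x z}) i x ↔ ∃ l, AlternatingWord P i x l := by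
  constructor
  · intro h
    induction h with
    | nil => exact ⟨[], .nil _⟩
    | append hx _ ih =>
      obtain ⟨z, hz⟩ := hx
      obtain ⟨l, hl⟩ := ih
      exact ⟨z :: l, .append hz hl⟩
  · rintro ⟨l, h⟩
    induction h with
    | nil => exact .nil _
    | append hx _ ih => exact .append ⟨_, hx⟩ ih

namespace FreeProductTable

open SemigroupFreeProduct Language

variable {B : Type} {S T : Type*} [Semigroup S] [Semigroup T]

/-- The words `u #₁ wʳᵉᵛ`, where `u` and `w` have the same value. -/
def equalPairs {Z : Type*} (P : List B → Z → Prop) : Language (MarkedLetter B) :=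
  {x | ∃ u w z, P u z ∧ P w z ∧ x = u.map .letter ++ .hash₁ :: w.reverse.map .letter}

/-- The words `u #₁ v #₂ wʳᵉᵛ`, where the product of the values of `u` and `v` reduces to the value
of `w`. -/
def productTriples (P : List B → S ⊕ T → Prop) : Language (MarkedLetter B) :=
  {x | ∃ u v w a b c, P u a ∧ P v b ∧ P w c ∧ consReduce a [b] = [c] ∧
    x = u.map .letter ++ .hash₁ :: (v.map .letter ++ .hash₂ :: w.reverse.map .letter)}

/-- The words `u #₁ v #₂ wʳᵉᵛ` with `u`, `v`, `w` non-empty alternating words, `u` and `w` beginning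
in factor `i`, such that the product of the values of `u` and `v` is the value of `w`. -/
def tableFrom (P : Bool → List B → S ⊕ T → Prop) (i : Bool) : Language (MarkedLetter B) :=
  {x | ∃ u v w j lu lv, AlternatingWord P i u lu ∧ AlternatingWord P j v lv ∧
    AlternatingWord P i w (lu.foldr consReduce lv) ∧ lu ≠ [] ∧ lv ≠ [] ∧
    x = u.map .letter ++ .hash₁ :: (v.map .letter ++ .hash₂ :: w.reverse.map .letter)}

/-- The words `v #₂ wʳᵉᵛ` with `v` and `w` alternating words of the same value beginning in
factor `i`, possibly empty. -/
def matchedFrom (P : Bool → List B → S ⊕ T → Prop) (i : Bool) : Language (MarkedLetter B) :=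
  {x | ∃ v w l, AlternatingWord P i v l ∧ AlternatingWord P i w l ∧
    x = v.map .letter ++ .hash₂ :: w.reverse.map .letter}

/-- The words of `matchedFrom P i` given by non-empty alternating words. -/
def nonemptyMatchedFrom (P : Bool → List B → S ⊕ T → Prop) (i : Bool) :
    Language (MarkedLetter B) :=
  {x | ∃ v w l, AlternatingWord P i v l ∧ AlternatingWord P i w l ∧ l ≠ [] ∧
    x = v.map .letter ++ .hash₂ :: w.reverse.map .letter}

/-- The nonterminals of the system for the multiplication table of a free product. -/
inductive NT : Type
  | start : NT
  | table (i : Bool) : NT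
  | matched (i : Bool) : NT
  | nonemptyMatched (i : Bool) : NT

instance : Finite NT :=
  Finite.of_injective (β := Option (Option Bool × Bool)) (fun
    | .start => none
    | .table i => some (none, i)
    | .matched i => some (some true, i)
    | .nonemptyMatched i => some (some false, i)) <| by
    rintro (_ | i | i | i) (_ | j | j | j) h <;> simp_all

/-- The homomorphism that replaces the marks `#₁` and `#₂` by given strings. -/
def replaceMarks {N : Type} (s₁ s₂ : List (Symbol (MarkedLetter B) N)) :
    MarkedLetter B → List (Symbol (MarkedLetter B) N)
  | .letter b => [.terminal (.letter b)]
  | .hash₁ => s₁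
  | .hash₂ => s₂

lemma flatMap_replaceMarks {N : Type} (s₁ s₂ : List (Symbol (MarkedLetter B) N)) (u : List B) :
    (u.map MarkedLetter.letter).flatMap (replaceMarks s₁ s₂) =
      (u.map MarkedLetter.letter).map .terminal := by
  induction u with
  | nil => rfl
  | cons b u ih => simpa [replaceMarks] using ih

/-- The image of a language under the homomorphism that replaces the marks by given strings. -/
def markReplacement {N : Type} (L : Language (MarkedLetter B))
    (s₁ s₂ : List (Symbol (MarkedLetter B) N)) : Language (Symbol (MarkedLetter B) N) :=
  {s | ∃ x ∈ L, s = x.flatMap (replaceMarks s₁ s₂)}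

lemma isContextFree_markReplacement {N : Type} {L : Language (MarkedLetter B)}
    (hL : L.IsContextFree) (s₁ s₂ : List (Symbol (MarkedLetter B) N)) :
    (markReplacement L s₁ s₂).IsContextFree :=
  (hL.flatMap (replaceMarks s₁ s₂) [] []).congr fun s ↦ by
    change (∃ x ∈ L, _) ↔ ∃ x ∈ L, _
    simp only [List.nil_append, List.append_nil]

/-- The right-hand sides of the system for the multiplication table of a free product. -/
def system (P : Bool → List B → S ⊕ T → Prop) : NT → Language (Symbol (MarkedLetter B) NT)
  | .start => {s | s = [.nonterminal (NT.table true)] ∨ s = [.nonterminal (NT.table false)]}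
  | .table i =>
    -- The first summand peels the first piece off a longer `u`. In the other two `u` is a single
    -- piece, and `v` begins in the other factor or in the same one. In the last case the rest of
    -- `v` may be empty.
    markReplacement (equalPairs (P i)) [.nonterminal (NT.table !i)] [] +
    (markReplacement (equalPairs (P i))
      [.terminal .hash₁, .nonterminal (NT.nonemptyMatched !i)] [] +
    markReplacement (productTriples (P i)) [.terminal .hash₁] [.nonterminal (NT.matched !i)])
  | .matched i => {s | s = [.terminal .hash₂] ∨ s = [.nonterminal (NT.nonemptyMatched i)]}
  | .nonemptyMatched i =>
    markReplacement (equalPairs (P i)) [.nonterminal (NT.matched !i)] []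

/-- The languages described by the nonterminals. -/
def solution (P : Bool → List B → S ⊕ T → Prop) : NT → Language (MarkedLetter B)
  | .start => {x | ∃ i, x ∈ tableFrom P i}
  | .table i => tableFrom P i
  | .matched i => matchedFrom P i
  | .nonemptyMatched i => nonemptyMatchedFrom P i

variable {P : Bool → List B → S ⊕ T → Prop}

lemma isContextFree_system (hE : ∀ i, (equalPairs (P i)).IsContextFree)
    (hT : ∀ i, (productTriples (P i)).IsContextFree) (n : NT) : (system P n).IsContextFree := by
  cases n with
  | start =>
    exact isContextFree_of_finite (L := system P .start)
      ((Set.finite_singleton _).union (Set.finite_singleton _))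
  | table i =>
    exact (isContextFree_markReplacement (hE i) _ _).add
      ((isContextFree_markReplacement (hE i) _ _).add (isContextFree_markReplacement (hT i) _ _))
  | matched i =>
    exact isContextFree_of_finite (L := system P (.matched i))
      ((Set.finite_singleton _).union (Set.finite_singleton _))
  | nonemptyMatched i => exact isContextFree_markReplacement (hE i) _ _

lemma mem_yield_wrapped {N : Type} {J : N → Language (MarkedLetter B)} {u w : List B}
    {s : List (Symbol (MarkedLetter B) N)} {x : List (MarkedLetter B)} :
    x ∈ yield J ((u.map MarkedLetter.letter).map .terminal ++ (s ++
      (w.reverse.map MarkedLetter.letter).map .terminal)) ↔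
      ∃ y ∈ yield J s, x = u.map .letter ++ (y ++ w.reverse.map .letter) := by
  rw [mem_yield_map_terminal_append]
  simp only [mem_yield_append, mem_yield_map_terminal]
  constructor
  · rintro ⟨_, ⟨y, hy, _, rfl, rfl⟩, rfl⟩
    exact ⟨y, hy, rfl⟩
  · rintro ⟨y, hy, rfl⟩
    exact ⟨_, ⟨y, hy, _, rfl, rfl⟩, rfl⟩

lemma flatMap_equalPair {N : Type} (s₁ s₂ : List (Symbol (MarkedLetter B) N)) (u w : List B) :
    (u.map MarkedLetter.letter ++ MarkedLetter.hash₁ ::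
        w.reverse.map MarkedLetter.letter).flatMap (replaceMarks s₁ s₂) =
      (u.map MarkedLetter.letter).map .terminal ++ (s₁ ++
        (w.reverse.map MarkedLetter.letter).map .terminal) := by
  simp only [List.flatMap_append, List.flatMap_cons, flatMap_replaceMarks]
  rfl

lemma flatMap_productTriple {N : Type} (s₁ s₂ : List (Symbol (MarkedLetter B) N)) (u v w : List B) :
    (u.map MarkedLetter.letter ++ MarkedLetter.hash₁ :: (v.map MarkedLetter.letter ++
        MarkedLetter.hash₂ :: w.reverse.map MarkedLetter.letter)).flatMap (replaceMarks s₁ s₂) =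
      (u.map MarkedLetter.letter).map .terminal ++
        ((s₁ ++ ((v.map MarkedLetter.letter).map .terminal ++ s₂)) ++
        (w.reverse.map MarkedLetter.letter).map .terminal) := by
  simp only [List.flatMap_append, List.flatMap_cons, flatMap_replaceMarks, List.append_assoc]
  rfl

/-- The absence of a cascade: whatever happens at the junction with `lv`, the first entry of the
product stays in the factor of the first entry of `l`, so `z` cannot merge with it. -/
lemma foldr_consReduce_of_alternating (hP : ∀ i x z, P i x z → z.isLeft = i) {i : Bool}
    {u : List B} {l lv : List (S ⊕ T)} (h : AlternatingWord P (!i) u l) (hl : l ≠ []) {z : S ⊕ T}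
    (hz : z.isLeft = i) : consReduce z (l.foldr consReduce lv) = z :: l.foldr consReduce lv := by
  cases l with
  | nil => exact absurd rfl hl
  | cons y l =>
    obtain ⟨c, m, hm, hc⟩ := exists_consReduce_eq_cons y (l.foldr consReduce lv)
    rw [List.foldr_cons, hm, consReduce_of_isLeft_ne]
    rw [hz, hc, h.isLeft_eq hP]
    cases i <;> simp

lemma consReduce_of_alternating (hP : ∀ i x z, P i x z → z.isLeft = i) {i : Bool}
    {u : List B} {l : List (S ⊕ T)} (h : AlternatingWord P (!i) u l) {z : S ⊕ T}
    (hz : z.isLeft = i) : consReduce z l = z :: l := by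
  cases l with
  | nil => exact consReduce_nil z
  | cons y l =>
    rw [consReduce_of_isLeft_ne]
    rw [hz, h.isLeft_eq hP]
    cases i <;> simp

lemma foldr_consReduce_nil (hP : ∀ i x z, P i x z → z.isLeft = i) {i : Bool} {u : List B}
    {l : List (S ⊕ T)} (h : AlternatingWord P i u l) : l.foldr consReduce [] = l := by
  induction h with
  | nil => rfl
  | append hx hy ih => rw [List.foldr_cons, ih, consReduce_of_alternating hP hy (hP _ _ _ hx)]

/-- Soundness of the grammar: the intended languages are closed under the system and hence contain
its least solution. -/
lemma yield_solution (hP : ∀ i x z, P i x z → z.isLeft = i) (n : NT)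
    (s : List (Symbol (MarkedLetter B) NT)) (hs : s ∈ system P n) (x : List (MarkedLetter B))
    (hx : x ∈ yield (solution P) s) : x ∈ solution P n := by
  cases n with
  | start =>
    rcases hs with rfl | rfl
    all_goals
      obtain ⟨y, hy, _, rfl, rfl⟩ := hx
      rw [List.append_nil]
      exact ⟨_, hy⟩
  | table i =>
    rcases hs with ⟨_, ⟨u₀, w₀, z, hu₀, hw₀, rfl⟩, rfl⟩ | ⟨_, ⟨u₀, w₀, z, hu₀, hw₀, rfl⟩, rfl⟩ |
      ⟨_, ⟨u₀, v₀, w₀, a, b, c, ha, hb, hc, habc, rfl⟩, rfl⟩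
    · rw [flatMap_equalPair, mem_yield_wrapped] at hx
      obtain ⟨_, ⟨_, ⟨u, v, w, j, lu, lv, hu, hv, hw, hlu, hlv, rfl⟩, _, rfl, rfl⟩, rfl⟩ := hx
      refine ⟨u₀ ++ u, v, w₀ ++ w, j, z :: lu, lv, .append hu₀ hu, hv, ?_, List.cons_ne_nil _ _,
        hlv, by simp⟩
      rw [List.foldr_cons, foldr_consReduce_of_alternating hP hu hlu (hP _ _ _ hu₀)]
      exact .append hw₀ hw
    · rw [flatMap_equalPair, mem_yield_wrapped] at hx
      obtain ⟨_, ⟨_, ⟨_, ⟨v, w, l, hv, hw, hl, rfl⟩, _, rfl, rfl⟩, rfl⟩, rfl⟩ := hx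
      refine ⟨u₀, v, w₀ ++ w, !i, [z], l, ?_, hv, ?_, List.cons_ne_nil _ _, hl, by simp⟩
      · simpa using AlternatingWord.append hu₀ (.nil _)
      · rw [List.foldr_cons, List.foldr_nil, consReduce_of_alternating hP hv (hP _ _ _ hu₀)]
        exact .append hw₀ hw
    · rw [flatMap_productTriple, mem_yield_wrapped] at hx
      obtain ⟨_, ⟨_, hy, rfl⟩, rfl⟩ := hx
      obtain ⟨_, ⟨_, ⟨v, w, l, hv, hw, rfl⟩, _, rfl, rfl⟩, rfl⟩ :=
        mem_yield_map_terminal_append.1 hy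
      refine ⟨u₀, v₀ ++ v, w₀ ++ w, i, [a], b :: l, ?_, .append hb hv, ?_, List.cons_ne_nil _ _,
        List.cons_ne_nil _ _, by simp⟩
      · simpa using AlternatingWord.append ha (.nil _)
      -- The merged entry does not depend on the tail of the list, so it is the `c` found with the
      -- empty tail.
      · obtain ⟨c', -, h⟩ := exists_consReduce_of_isLeft_eq
          ((hP _ _ _ ha).trans (hP _ _ _ hb).symm)
        rw [h, List.cons.injEq] at habc
        rw [List.foldr_cons, List.foldr_nil, h, habc.1]
        exact .append hc hw
  | matched i =>
    rcases hs with rfl | rfl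
    · obtain ⟨_, rfl, rfl⟩ := hx
      exact ⟨[], [], [], .nil _, .nil _, rfl⟩
    · obtain ⟨_, ⟨v, w, l, hv, hw, -, rfl⟩, _, rfl, rfl⟩ := hx
      exact ⟨v, w, l, hv, hw, by simp⟩
  | nonemptyMatched i =>
    obtain ⟨_, ⟨u₀, w₀, z, hu₀, hw₀, rfl⟩, rfl⟩ := hs
    rw [flatMap_equalPair, mem_yield_wrapped] at hx
    obtain ⟨_, ⟨_, ⟨v, w, l, hv, hw, rfl⟩, _, rfl, rfl⟩, rfl⟩ := hx
    exact ⟨u₀ ++ v, w₀ ++ w, z :: l, .append hu₀ hv, .append hw₀ hw, List.cons_ne_nil _ _,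
      by simp⟩

lemma mem_leastSolution_nonemptyMatched {i : Bool} {u w : List B} {z : S ⊕ T} (hu : P i u z)
    (hw : P i w z) {x : List (MarkedLetter B)}
    (hx : x ∈ leastSolution (system P) (.matched !i)) :
    u.map .letter ++ (x ++ w.reverse.map .letter) ∈
      leastSolution (system P) (.nonemptyMatched i) := by
  refine mem_leastSolution_of_yield (K := system P) (n := .nonemptyMatched i)
    ⟨_, ⟨u, w, z, hu, hw, rfl⟩, rfl⟩ ?_
  rw [flatMap_equalPair, mem_yield_wrapped]
  exact ⟨_, ⟨x, hx, [], rfl, by simp⟩, rfl⟩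

lemma mem_leastSolution_matched {i : Bool} {v w : List B} {l : List (S ⊕ T)}
    (hv : AlternatingWord P i v l) (hw : AlternatingWord P i w l) :
    v.map .letter ++ .hash₂ :: w.reverse.map .letter ∈
      leastSolution (system P) (.matched i) := by
  induction hv generalizing w with
  | nil i =>
    cases hw
    exact mem_leastSolution_of_yield (K := system P) (n := .matched i)
      (s := [.terminal .hash₂]) (Or.inl rfl) ⟨[], rfl, rfl⟩
  | @append i _ _ _ _ hx _ ih =>
    cases hw with
    | append hx' hy' =>
      exact mem_leastSolution_of_yield (K := system P) (n := .matched i)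
        (s := [.nonterminal (.nonemptyMatched i)]) (Or.inr rfl)
        ⟨_, mem_leastSolution_nonemptyMatched hx hx' (ih hy'), [], rfl, by simp⟩

/-- Completeness of the grammar: pieces are peeled off `u` and `w` together until one piece of `u`
is left, and the factor in which `v` begins decides the rule at the junction. -/
lemma mem_leastSolution_table (hP : ∀ i x z, P i x z → z.isLeft = i) {i j : Bool}
    {u v w : List B} {lu lv : List (S ⊕ T)} (hu : AlternatingWord P i u lu)
    (hv : AlternatingWord P j v lv) (hw : AlternatingWord P i w (lu.foldr consReduce lv))
    (hlu : lu ≠ []) (hlv : lv ≠ []) :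
    u.map .letter ++ .hash₁ :: (v.map .letter ++ .hash₂ :: w.reverse.map .letter) ∈
      leastSolution (system P) (.table i) := by
  induction hu generalizing w with
  | nil => exact absurd rfl hlu
  | @append i x y z l hx hy ih =>
    rcases eq_or_ne l [] with rfl | hl
    · cases hy
      rw [List.foldr_cons, List.foldr_nil] at hw
      cases hv with
      | nil => exact absurd rfl hlv
      | @append _ v₀ v b lv hb hv =>
        by_cases hij : i = j
        · subst hij
          obtain ⟨c, -, hc⟩ := exists_consReduce_of_isLeft_eq
            ((hP _ _ _ hx).trans (hP _ _ _ hb).symm)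
          rw [hc] at hw
          cases hw with
          | append hw₀ hw =>
            refine mem_leastSolution_of_yield (K := system P) (n := .table i)
              (Or.inr (Or.inr ⟨_, ⟨_, _, _, _, _, _, hx, hb, hw₀, hc [], rfl⟩, rfl⟩)) ?_
            rw [flatMap_productTriple, mem_yield_wrapped]
            refine ⟨_, ⟨_, mem_yield_map_terminal_append.2
              ⟨_, ⟨_, mem_leastSolution_matched hv hw, [], rfl, rfl⟩, rfl⟩, rfl⟩, by simp⟩
        · obtain rfl : j = !i := by
            cases i <;> cases j <;> simp_all
          -- Nothing merges here, so the first two pieces of `w` face the single piece of `u` and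
          -- the first piece of `v`.
          have hv' := AlternatingWord.append hb hv
          rw [consReduce_of_alternating hP hv' (hP _ _ _ hx)] at hw
          cases hw with
          | append hw₀ hw =>
            cases hw with
            | append hw₁ hw =>
              refine mem_leastSolution_of_yield (K := system P) (n := .table i)
                (Or.inr (Or.inl ⟨_, ⟨_, _, _, hx, hw₀, rfl⟩, rfl⟩)) ?_
              rw [flatMap_equalPair, mem_yield_wrapped]
              refine ⟨_, ⟨_, ⟨_, mem_leastSolution_nonemptyMatched hb hw₁
                (mem_leastSolution_matched hv hw), [], rfl, rfl⟩, rfl⟩, by simp⟩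
    · rw [List.foldr_cons, foldr_consReduce_of_alternating hP hy hl (hP _ _ _ hx)] at hw
      cases hw with
      | append hw₀ hw =>
        refine mem_leastSolution_of_yield (K := system P) (n := .table i)
          (Or.inl ⟨_, ⟨_, _, _, hx, hw₀, rfl⟩, rfl⟩) ?_
        rw [flatMap_equalPair, mem_yield_wrapped]
        exact ⟨_, ⟨_, ih hw hl, [], rfl, rfl⟩, by simp⟩

/-- The multiplication table of a free product is context-free if multiplication and equality are
context-free in the factors. -/
theorem isContextFree_tableFrom (hP : ∀ i x z, P i x z → z.isLeft = i)
    (hE : ∀ i, (equalPairs (P i)).IsContextFree)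
    (hT : ∀ i, (productTriples (P i)).IsContextFree) :
    Language.IsContextFree {x | ∃ i, x ∈ tableFrom P i} := by
  refine (isContextFree_leastSolution (system P) .start (isContextFree_system hE hT)).congr
    fun x ↦ ⟨?_, fun hx ↦ leastSolution_subset (solution P) (yield_solution hP) hx⟩
  rintro ⟨i, u, v, w, j, lu, lv, hu, hv, hw, hlu, hlv, rfl⟩
  refine mem_leastSolution_of_yield (K := system P) (n := .start)
    (s := [.nonterminal (.table i)]) ?_
    ⟨_, mem_leastSolution_table hP hu hv hw hlu hlv, [], rfl, by simp⟩
  cases i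
  · exact Or.inr rfl
  · exact Or.inl rfl

end FreeProductTable

/-! ### The combing of the free product from combings of the factors -/

namespace FreeProductTable

open SemigroupFreeProduct Language

/-- The words over the alphabet of one factor that lie in a given combing, together with
their values, as words over the union of the alphabets with values in the union of the factors. -/
def combingPiece {A B : Type} {S Z : Type*} (word : A → B) (value : S → Z)
    (π : FreeSemigroup A → S) (R : Set (FreeSemigroup A)) (x : List B) (z : Z) : Prop :=
  ∃ w ∈ R, x = w.toWord.map word ∧ z = value (π w)

/-- The map of alphabets with marks induced by a map of alphabets. -/
def mapLetter {A B : Type} (f : A → B) : MarkedLetter A → MarkedLetter B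
  | .letter a => .letter (f a)
  | .hash₁ => .hash₁
  | .hash₂ => .hash₂

lemma map_mapLetter {A B : Type} (f : A → B) (x : List A) :
    (x.map MarkedLetter.letter).map (mapLetter f) = (x.map f).map MarkedLetter.letter := by
  simp [Function.comp_def, mapLetter]

section combingPiece

variable {A B : Type} {S Z : Type*} {π : FreeSemigroup A → S} {R : Set (FreeSemigroup A)}
  {word : A → B} {value : S → Z}

lemma isContextFree_equalPairs_combingPiece (hv : Function.Injective value)
    (hE : (equalityLanguage FreeSemigroup.toWord π R).IsContextFree) :
    (equalPairs (combingPiece word value π R)).IsContextFree := by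
  refine (hE.map (mapLetter word)).congr fun x ↦ ?_
  constructor
  · rintro ⟨_, _, _, ⟨u, hu, rfl, rfl⟩, ⟨w, hw, rfl, h⟩, rfl⟩
    refine ⟨_, ⟨u, hu, w, hw, hv h, rfl⟩, ?_⟩
    simp only [List.map_append, List.map_cons, map_mapLetter, List.map_reverse]
    rfl
  · rintro ⟨_, ⟨u, hu, w, hw, h, rfl⟩, rfl⟩
    refine ⟨_, _, _, ⟨u, hu, rfl, rfl⟩, ⟨w, hw, rfl, congrArg value h⟩, ?_⟩
    simp only [List.map_append, List.map_cons, map_mapLetter, List.map_reverse]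
    rfl

lemma isContextFree_productTriples_combingPiece {S₁ S₂ : Type*} [Semigroup S₁] [Semigroup S₂]
    [Mul S] {value : S → S₁ ⊕ S₂} (hv : Function.Injective value)
    (hmul : ∀ a b, consReduce (value a) [value b] = [value (a * b)])
    (hT : (multiplicationTable FreeSemigroup.toWord π R).IsContextFree) :
    (productTriples (combingPiece word value π R)).IsContextFree := by
  refine (hT.map (mapLetter word)).congr fun x ↦ ?_
  constructor
  · rintro ⟨_, _, _, _, _, _, ⟨u, hu, rfl, rfl⟩, ⟨v, hv', rfl, rfl⟩, ⟨w, hw, rfl, rfl⟩, h, rfl⟩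
    rw [hmul] at h
    refine ⟨_, mem_multiplicationTable.2
      ⟨u, hu, v, hv', w, hw, hv (List.singleton_injective h), rfl⟩, ?_⟩
    simp only [List.map_append, List.map_cons, map_mapLetter, List.map_reverse]
    rfl
  · rintro ⟨_, hx, rfl⟩
    obtain ⟨u, hu, v, hv', w, hw, h, rfl⟩ := mem_multiplicationTable.1 hx
    refine ⟨_, _, _, _, _, _, ⟨u, hu, rfl, rfl⟩, ⟨v, hv', rfl, rfl⟩, ⟨w, hw, rfl, rfl⟩,
      by rw [hmul, h], ?_⟩
    simp only [List.map_append, List.map_cons, map_mapLetter, List.map_reverse]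
    rfl

lemma isRegular_combingPiece (hR : (wordLanguage FreeSemigroup.toWord R).IsRegular) :
    Language.IsRegular {x | ∃ z, combingPiece word value π R x z} := by
  refine (hR.map_letters word).congr fun x ↦ ?_
  constructor
  · rintro ⟨_, w, hw, rfl, rfl⟩
    exact ⟨_, ⟨w, hw, rfl⟩, rfl⟩
  · rintro ⟨_, ⟨w, hw, rfl⟩, rfl⟩
    exact ⟨_, w, hw, rfl, rfl⟩

lemma ne_nil_of_combingPiece {x : List B} {z : Z} (h : combingPiece word value π R x z) :
    x ≠ [] := by
  obtain ⟨w, -, rfl, -⟩ := h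
  simp [FreeSemigroup.toWord]

/-- Acting letter by letter agrees with acting by the value of the piece, because the action is
multiplicative within each factor. -/
lemma foldr_consReduce_of_combingPiece {S₁ S₂ : Type*} [Semigroup S₁] [Semigroup S₂]
    [Semigroup S] {value : S → S₁ ⊕ S₂} {π : FreeSemigroup A →ₙ* S} {lv : B → S₁ ⊕ S₂}
    (hmul : ∀ a b l, consReduce (value (a * b)) l = consReduce (value a) (consReduce (value b) l))
    (hlv : ∀ a, lv (word a) = value (π (.of a))) {x : List B} {z : S₁ ⊕ S₂}
    (h : combingPiece word value π R x z) (l : List (S₁ ⊕ S₂)) :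
    x.foldr (fun b ↦ consReduce (lv b)) l = consReduce z l := by
  obtain ⟨w, -, rfl, rfl⟩ := h
  induction w using FreeSemigroup.recOnMul generalizing l with
  | ih1 a => simp [FreeSemigroup.toWord_of, hlv]
  | ih2 a w ha hw =>
    rw [FreeSemigroup.toWord_mul, List.map_append, List.foldr_append, ha, hw, map_mul, hmul]

end combingPiece

section

variable {B : Type} {S T : Type*} [Semigroup S] [Semigroup T]
  {P : Bool → List B → S ⊕ T → Prop}

lemma foldr_of_alternatingWord {lv : B → S ⊕ T}
    (h : ∀ i x z, P i x z → ∀ l, x.foldr (fun b ↦ consReduce (lv b)) l = consReduce z l) {i : Bool}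
    {x : List B} {m : List (S ⊕ T)} (hx : AlternatingWord P i x m) (l : List (S ⊕ T)) :
    x.foldr (fun b ↦ consReduce (lv b)) l = m.foldr consReduce l := by
  induction hx with
  | nil => rfl
  | append hx _ ih => rw [List.foldr_append, ih, h _ _ _ hx, List.foldr_cons]

/-- Left multiplication by `z` affects only the front: either the first piece is replaced by a
representative of the merged entry, or a piece for `z` is added. -/
lemma exists_alternatingWord_consReduce (hP : ∀ i x z, P i x z → z.isLeft = i)
    (hsurj : ∀ z, ∃ x, P z.isLeft x z) (z : S ⊕ T) {i : Bool} {x : List B} {l : List (S ⊕ T)}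
    (h : AlternatingWord P i x l) : ∃ i x, AlternatingWord P i x (consReduce z l) := by
  obtain ⟨y, hy⟩ := hsurj z
  cases h with
  | nil =>
    rw [consReduce_nil]
    exact ⟨_, _, .append hy (.nil _)⟩
  | append hx hm =>
    rename_i z' _
    by_cases hz : z.isLeft = z'.isLeft
    · obtain ⟨c, hc, h⟩ := exists_consReduce_of_isLeft_eq hz
      rw [h]
      obtain ⟨y, hy⟩ := hsurj c
      rw [hc, hP _ _ _ hx] at hy
      exact ⟨_, _, .append hy hm⟩
    · rw [consReduce_of_isLeft_ne hz]
      obtain rfl : i = !z.isLeft := by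
        rw [hP _ _ _ hx] at hz
        revert hz
        cases z.isLeft <;> cases i <;> simp
      exact ⟨_, _, .append hy (.append hx hm)⟩

lemma exists_alternatingWord_act (hP : ∀ i x z, P i x z → z.isLeft = i)
    (hsurj : ∀ z, ∃ x, P z.isLeft x z) (g : SemigroupFreeProduct S T) :
    ∃ i x, AlternatingWord P i x (act g []) := by
  induction g using SemigroupFreeProduct.induction_on with
  | h₁ z => exact exists_alternatingWord_consReduce hP hsurj z (.nil true)
  | h₂ z g ih =>
    obtain ⟨i, x, h⟩ := ih
    rw [act_mul, act_of]
    exact exists_alternatingWord_consReduce hP hsurj z h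

/-- The free product is word-hyperbolic if its factors have regular combings for which
multiplication and equality are context-free. -/
theorem isWordHyperbolicSemigroup_of_pieces [Finite B] (lv : B → S ⊕ T)
    (hP : ∀ i x z, P i x z → z.isLeft = i) (hne : ∀ i x z, P i x z → x ≠ [])
    (hsurj : ∀ z, ∃ x, P z.isLeft x z)
    (hlv : ∀ i x z, P i x z → ∀ l, x.foldr (fun b ↦ consReduce (lv b)) l = consReduce z l)
    (hreg : ∀ i, Language.IsRegular {x | ∃ z, P i x z})
    (hE : ∀ i, (equalPairs (P i)).IsContextFree)
    (hT : ∀ i, (productTriples (P i)).IsContextFree) :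
    IsWordHyperbolicSemigroup (SemigroupFreeProduct S T) := by
  let π : FreeSemigroup B →ₙ* SemigroupFreeProduct S T :=
    FreeSemigroup.lift fun b ↦ SemigroupFreeProduct.of (lv b)
  let R : Set (FreeSemigroup B) := {w | ∃ i l, AlternatingWord P i w.toWord l}
  have hact {i : Bool} {w : FreeSemigroup B} {m : List (S ⊕ T)}
      (h : AlternatingWord P i w.toWord m) (l : List (S ⊕ T)) :
      act (π w) l = m.foldr consReduce l := by
    rw [act_lift, foldr_of_alternatingWord hlv h]
  -- The values of the pieces of a combing word are thus the normal form of the element that it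
  -- represents.
  have hact' {i : Bool} {w : FreeSemigroup B} {m : List (S ⊕ T)}
      (h : AlternatingWord P i w.toWord m) : act (π w) [] = m := by
    rw [hact h, foldr_consReduce_nil hP h]
  have hval {i : Bool} {w : FreeSemigroup B} {m : List (S ⊕ T)}
      (h : AlternatingWord P i w.toWord m) : m ≠ [] := fun e ↦
    w.toWord_ne_nil ((h.eq_nil_iff hne).2 e)
  have hR : π '' R = Set.univ := by
    refine Set.eq_univ_of_forall fun g ↦ ?_
    obtain ⟨i, x, h⟩ := exists_alternatingWord_act hP hsurj g
    have hx : x ≠ [] := by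
      rw [Ne, h.eq_nil_iff hne]
      induction g using SemigroupFreeProduct.induction_on with
      | h₁ z => simp [act_of, consReduce_nil]
      | h₂ z g _ =>
        rw [act_mul, act_of]
        obtain ⟨c, l, hl, -⟩ := exists_consReduce_eq_cons z (act g [])
        simp [hl]
    obtain ⟨w, rfl⟩ := FreeSemigroup.exists_toWord_eq hx
    exact ⟨w, ⟨i, _, h⟩, act_nil_injective (hact' h)⟩
  refine ⟨B, inferInstance, π, R, fun g ↦ ?_, ?_, hR, ?_⟩
  · obtain ⟨w, -, hw⟩ : g ∈ π '' R := hR ▸ Set.mem_univ g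
    exact ⟨w, hw⟩
  · refine (isRegular_alternating hreg fun i ⟨z, h⟩ ↦ hne _ _ _ h rfl).congr fun x ↦ ?_
    constructor
    · rintro ⟨w, ⟨i, l, h⟩, rfl⟩
      exact ⟨w.toWord_ne_nil, i, isAlternating_iff.2 ⟨l, h⟩⟩
    · rintro ⟨hx, i, h⟩
      obtain ⟨w, rfl⟩ := FreeSemigroup.exists_toWord_eq hx
      exact ⟨w, ⟨i, isAlternating_iff.1 h⟩, rfl⟩
  · refine (isContextFree_tableFrom hP hE hT).congr fun x ↦ ?_
    rw [mem_multiplicationTable]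
    constructor
    · rintro ⟨u, ⟨i, lu, hu⟩, v, ⟨j, lv, hv⟩, w, ⟨k, lw, hw⟩, h, rfl⟩
      have hlw : lu.foldr consReduce lv = lw := by
        rw [← hact' hw, ← h, act_mul, hact' hv, hact hu]
      -- The product begins in the same factor as `u`, which is why `tableFrom` has one index for
      -- both `u` and `w`.
      have hki : k = i := by
        subst hlw
        cases lu with
        | nil => exact absurd rfl (hval hu)
        | cons z l =>
          obtain ⟨c, m, hm, hc⟩ := exists_consReduce_eq_cons z (l.foldr consReduce lv)
          rw [List.foldr_cons, hm] at hw
          rw [← hw.isLeft_eq hP, hc, hu.isLeft_eq hP]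
      subst hki hlw
      exact ⟨k, _, _, _, _, _, _, hu, hv, hw, hval hu, hval hv, rfl⟩
    · rintro ⟨i, u, v, w, j, lu, lv, hu, hv, hw, hlu, hlv, rfl⟩
      obtain ⟨u, rfl⟩ := FreeSemigroup.exists_toWord_eq
        (mt (hu.eq_nil_iff hne).1 hlu)
      obtain ⟨v, rfl⟩ := FreeSemigroup.exists_toWord_eq
        (mt (hv.eq_nil_iff hne).1 hlv)
      have hlw : lu.foldr consReduce lv ≠ [] := by
        cases lu with
        | nil => exact absurd rfl hlu
        | cons z l =>
          obtain ⟨c, m, hm, -⟩ := exists_consReduce_eq_cons z (l.foldr consReduce lv)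
          simp [hm]
      obtain ⟨w, rfl⟩ := FreeSemigroup.exists_toWord_eq
        (mt (hw.eq_nil_iff hne).1 hlw)
      refine ⟨u, ⟨i, lu, hu⟩, v, ⟨j, lv, hv⟩, w, ⟨i, _, hw⟩, act_nil_injective ?_, rfl⟩
      change act _ [] = act _ []
      rw [act_mul, hact' hv, hact hu, hact' hw]

end

end FreeProductTable

open FreeProductTable SemigroupFreeProduct in
/-- The free product of word-hyperbolic semigroups in which every element has a right identity is
word-hyperbolic. -/
theorem IsWordHyperbolicSemigroup.freeProduct {S T : Type*} [Semigroup S] [Semigroup T]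
    (hS : IsWordHyperbolicSemigroup S) (hT : IsWordHyperbolicSemigroup T)
    (heS : ∀ s : S, ∃ e, s * e = s) (heT : ∀ t : T, ∃ e, t * e = t) :
    IsWordHyperbolicSemigroup (SemigroupFreeProduct S T) := by
  obtain ⟨A₁, _, π₁, R₁, -, hreg₁, hR₁, hT₁⟩ := hS
  obtain ⟨A₂, _, π₂, R₂, -, hreg₂, hR₂, hT₂⟩ := hT
  have hE₁ := isContextFree_equalityLanguage π₁ R₁ hR₁ hT₁ heS
  have hE₂ := isContextFree_equalityLanguage π₂ R₂ hR₂ hT₂ heT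
  -- The index `true` belongs to the left factor, in agreement with `Sum.isLeft`.
  let P : Bool → List (A₁ ⊕ A₂) → S ⊕ T → Prop
    | true => combingPiece .inl .inl π₁ R₁
    | false => combingPiece .inr .inr π₂ R₂
  refine isWordHyperbolicSemigroup_of_pieces (P := P)
    (Sum.map (fun a ↦ π₁ (.of a)) fun a ↦ π₂ (.of a)) ?_ ?_ ?_ ?_ ?_ ?_ ?_
  · rintro (_ | _) x z ⟨w, -, -, rfl⟩ <;> rfl
  · rintro (_ | _) x z h
    · exact ne_nil_of_combingPiece h
    · exact ne_nil_of_combingPiece h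
  · rintro (s | t)
    · obtain ⟨w, hw, rfl⟩ : s ∈ π₁ '' R₁ := hR₁ ▸ Set.mem_univ s
      exact ⟨_, w, hw, rfl, rfl⟩
    · obtain ⟨w, hw, rfl⟩ : t ∈ π₂ '' R₂ := hR₂ ▸ Set.mem_univ t
      exact ⟨_, w, hw, rfl, rfl⟩
  · rintro (_ | _) x z h l
    · exact foldr_consReduce_of_combingPiece (S₁ := S) (S₂ := T) consReduce_inr_mul (fun _ ↦ rfl) h l
    · exact foldr_consReduce_of_combingPiece (S₁ := S) (S₂ := T) consReduce_inl_mul (fun _ ↦ rfl) h l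
  · rintro (_ | _)
    · exact isRegular_combingPiece hreg₂
    · exact isRegular_combingPiece hreg₁
  · rintro (_ | _)
    · exact isContextFree_equalPairs_combingPiece Sum.inr_injective hE₂
    · exact isContextFree_equalPairs_combingPiece Sum.inl_injective hE₁
  · rintro (_ | _)
    · exact isContextFree_productTriples_combingPiece Sum.inr_injective (fun _ _ ↦ rfl) hT₂
    · exact isContextFree_productTriples_combingPiece Sum.inl_injective (fun _ _ ↦ rfl) hT₁

theorem mainTheorem11 :
    (∀ (M₁ M₂ : Type*) [Monoid M₁] [Monoid M₂],
      IsWordHyperbolicMonoid M₁ → IsWordHyperbolicMonoid M₂ →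
        IsWordHyperbolicSemigroup (SemigroupFreeProduct M₁ M₂)) ∧
    (∀ (S₁ S₂ : Type*) [Semigroup S₁] [Semigroup S₂],
      IsVonNeumannRegular S₁ → IsVonNeumannRegular S₂ →
      IsWordHyperbolicSemigroup S₁ → IsWordHyperbolicSemigroup S₂ →
        IsWordHyperbolicSemigroup (SemigroupFreeProduct S₁ S₂)) := by
  refine ⟨fun M₁ M₂ _ _ h₁ h₂ ↦ ?_, fun S₁ S₂ _ _ hr₁ hr₂ h₁ h₂ ↦ ?_⟩
  · exact h₁.isWordHyperbolicSemigroup.freeProduct h₂.isWordHyperbolicSemigroup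
      (fun s ↦ ⟨1, mul_one s⟩) (fun t ↦ ⟨1, mul_one t⟩)
  · refine h₁.freeProduct h₂ (fun s ↦ ?_) (fun t ↦ ?_)
    · obtain ⟨b, hb⟩ := hr₁ s
      exact ⟨b * s, by rw [← mul_assoc, hb]⟩
    · obtain ⟨b, hb⟩ := hr₂ t
      exact ⟨b * t, by rw [← mul_assoc, hb]⟩
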